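/- **Theorem.** Let $V_1,V_2,V$ be pairwise commuting bounded operators on a complex Hilbert space $\mathcal H$ with $V=V_1V_2$. Let $\mathcal D_{V^*}=\overline{\operatorname{Ran}}(I-VV^*)$, let $H^2(\mathcal D_{V^*})$ be the Hardy space of power series $\sum_n z^na_n$ on the unit disc with $a_n\in\mathcal D_{V^*}$ and $\sum_n\|a_n\|^2<\infty$, and for $A,B\in\mathcal B(\mathcal D_{V^*})$ let $T_{A+zB}$ be the Toeplitz operator on $H^2(\mathcal D_{V^*})$ with symbol $\varphi(z)=A+zB$, i.e. $(T_\varphi f)(z)=\varphi(z)f(z)$. Then $(V_1,V_2,V)$ is a pure triangular $\mathbb E$-isometry if and only if there are a unitary $U:\mathcal H\to H^2(\mathcal D_{V^*})$, a unitary $W$ and an orthogonal projection $Q$ in $\mathcal B(\mathcal D_{V^*})$ such that, with $Q^\perp=I-Q$, $$UV_1=T_{Q^\perp W+zQW}\,U,\qquad UV_2=T_{W^*Q+zW^*Q^\perp}\,U,\qquad UV=T_z\,U .$$ Here $\mathbb E=\{(a_{11},a_{22},\det A): A=[a_{ij}]\in\mathcal M_2(\mathbb C),\ \|A\|<1\}$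 is the tetrablock and $b\overline{\mathbb E}=\{x\in\overline{\mathbb E}:|x_3|=1\}$. A commuting triple $(A,B,P)$ on $\mathcal H$ is an $\mathbb E$-*contraction* if its Taylor joint spectrum lies in $\overline{\mathbb E}$ and $\|f(A,B,P)\|\le\sup_{\overline{\mathbb E}}|f|$ for all rational functions $f=p/q$ such that $q$ has no zero in $\overline{\mathbb E}$, where $f(A,B,P)=p(A,B,P)\,q(A,B,P)^{-1}$; an $\mathbb E$-*unitary* if $A,B,P$ are normal and the Taylor joint spectrum lies in $b\overline{\mathbb E}$; an $\mathbb E$-*isometry* if it is the restriction of an $\mathbb E$-unitary on a Hilbert space $\mathcal K\supseteq\mathcal H$ to the joint invariant subspace $\mathcal H$. A *triangular* $\mathbb E$-*isometry* is an $\mathbb E$-contraction that is an $\mathbb E$-isometry of the form $(S,T,ST)$ with commuting contractions $S,T$; it is *pure* if its last component $P$ is a contraction with $P^{*n}\to0$ strongly. -/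

import Mathlib

open scoped ENNReal

universe u

/-! ## The tetrablock -/

/-- The tetrablock: the points `(a₁₁, a₂₂, det A)` for complex `2 × 2` matrices `A` whose operator
norm (with respect to the Euclidean norm of `ℂ²`) is less than `1`. -/
def tetrablock : Set (Fin 3 → ℂ) :=
  {x | ∃ A : Matrix (Fin 2) (Fin 2) ℂ,
    ‖Matrix.toEuclideanCLM (n := Fin 2) (𝕜 := ℂ) A‖ < 1 ∧ x = ![A 0 0, A 1 1, A.det]}

/-- The closed tetrablock. -/
def closedTetrablock : Set (Fin 3 → ℂ) := closure tetrablock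

/-- The distinguished boundary of the closed tetrablock. -/
def tetrablockBoundary : Set (Fin 3 → ℂ) := {x | x ∈ closedTetrablock ∧ ‖x 2‖ = 1}

/-! ## Commuting triples of operators and the Taylor joint spectrum -/

section Operators

variable {H : Type u} [NormedAddCommGroup H] [InnerProductSpace ℂ H]

/-- `A, B, P` commute pairwise. -/
structure CommutingTriple (A B P : H →L[ℂ] H) : Prop where
  comm_AB : Commute A B
  comm_AP : Commute A P
  comm_BP : Commute B P

/-- The map `K⁰ = H → K¹ = H³` of the Koszul complex of `(A, B, P)`. -/
def koszul0 (A B P : H →L[ℂ] H) (h : H) : H × H × H := (A h, B h, P h)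

/-- The map `K¹ = H³ → K² = H³` of the Koszul complex of `(A, B, P)`, in the bases
`e₁, e₂, e₃` and `e₁ ∧ e₂, e₁ ∧ e₃, e₂ ∧ e₃`. -/
def koszul1 (A B P : H →L[ℂ] H) (x : H × H × H) : H × H × H :=
  (A x.2.1 - B x.1, A x.2.2 - P x.1, B x.2.2 - P x.2.1)

/-- The map `K² = H³ → K³ = H` of the Koszul complex of `(A, B, P)`. -/
def koszul2 (A B P : H →L[ℂ] H) (x : H × H × H) : H :=
  A x.2.2 - B x.2.1 + P x.1

/-- Exactness of the Koszul complex `0 → H → H³ → H³ → H → 0` of the commuting triple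
`(A, B, P)`. -/
structure KoszulExact (A B P : H →L[ℂ] H) : Prop where
  injective : Function.Injective (koszul0 A B P)
  exact₁ : Function.Exact (koszul0 A B P) (koszul1 A B P)
  exact₂ : Function.Exact (koszul1 A B P) (koszul2 A B P)
  surjective : Function.Surjective (koszul2 A B P)

/-- The Taylor joint spectrum of a commuting triple: the points `z ∈ ℂ³` for which the Koszul
complex of `(A - z₁, B - z₂, P - z₃)` is not exact. -/
def taylorSpectrum (A B P : H →L[ℂ] H) : Set (Fin 3 → ℂ) :=
  {z | ¬ KoszulExact (A - z 0 • (1 : H →L[ℂ] H)) (B - z 1 • (1 : H →L[ℂ] H))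
    (P - z 2 • (1 : H →L[ℂ] H))}

/-- The operator `p(A, B, P)` for a polynomial `p` in three variables and a commuting triple. -/
noncomputable def polyCalc (p : MvPolynomial (Fin 3) ℂ) (A B P : H →L[ℂ] H) : H →L[ℂ] H :=
  ∑ m ∈ p.support, p.coeff m • (A ^ m 0 * B ^ m 1 * P ^ m 2)

/-- Tetrablock-contractions: commuting triples for which the closed tetrablock is a spectral set.
For `f = p / q` with `q` zero-free on the closed tetrablock, `f(A, B, P) = p(A, B, P) q(A, B, P)⁻¹`;
the invertibility of `q(A, B, P)` is stated explicitly. -/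
structure IsEContraction (A B P : H →L[ℂ] H) : Prop where
  comm : CommutingTriple A B P
  spectrum_subset : taylorSpectrum A B P ⊆ closedTetrablock
  vonNeumann : ∀ p q : MvPolynomial (Fin 3) ℂ, (∀ z ∈ closedTetrablock, q.eval z ≠ 0) →
    IsUnit (polyCalc q A B P) ∧
      ‖polyCalc p A B P * Ring.inverse (polyCalc q A B P)‖ ≤
        sSup ((fun z : Fin 3 → ℂ => ‖p.eval z / q.eval z‖) '' closedTetrablock)

variable [CompleteSpace H]

/-- Tetrablock-unitaries: commuting normal triples whose Taylor joint spectrum lies in the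
distinguished boundary. -/
structure IsEUnitary (A B P : H →L[ℂ] H) : Prop where
  comm : CommutingTriple A B P
  normal_A : IsStarNormal A
  normal_B : IsStarNormal B
  normal_P : IsStarNormal P
  spectrum_subset : taylorSpectrum A B P ⊆ tetrablockBoundary

/-- Tetrablock-isometries: commuting triples that are the restriction of a tetrablock-unitary on a
Hilbert space containing `H` (here via the linear isometry `J`) to the joint invariant
subspace `H`. -/
structure IsEIsometry (A B P : H →L[ℂ] H) : Prop where
  comm : CommutingTriple A B P
  extension : ∃ (K : Type u) (_ : NormedAddCommGroup K) (_ : InnerProductSpace ℂ K)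
    (_ : CompleteSpace K) (J : H →ₗᵢ[ℂ] K) (Q₁ Q₂ N : K →L[ℂ] K),
      IsEUnitary Q₁ Q₂ N ∧
        ∀ h : H, Q₁ (J h) = J (A h) ∧ Q₂ (J h) = J (B h) ∧ N (J h) = J (P h)

/-- Triangular tetrablock-isometries: tetrablock-contractions that are tetrablock-isometries of the
form `(S, T, S T)` with commuting contractions `S, T`. -/
structure IsTriangularEIsometry (A B P : H →L[ℂ] H) : Prop where
  isEContraction : IsEContraction A B P
  isEIsometry : IsEIsometry A B P
  triangular : ∃ S T : H →L[ℂ] H, Commute S T ∧ ‖S‖ ≤ 1 ∧ ‖T‖ ≤ 1 ∧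
    A = S ∧ B = T ∧ P = S * T

/-- `C.₀` contractions: `P` is a contraction and `P*ⁿ → 0` strongly. -/
def IsPureContraction (P : H →L[ℂ] H) : Prop :=
  ‖P‖ ≤ 1 ∧ ∀ h : H, Filter.Tendsto (fun n : ℕ => (star P ^ n) h) Filter.atTop (nhds 0)

/-- Pure triangular tetrablock-isometries: those whose last component is a `C.₀` contraction. -/
structure IsPureTriangularEIsometry (A B P : H →L[ℂ] H) : Prop where
  triangular : IsTriangularEIsometry A B P
  pure : IsPureContraction P

/-- The defect space `𝒟_T`, the closure of the range of `I - T* T`. -/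
noncomputable abbrev defectSpace (T : H →L[ℂ] H) : Submodule ℂ H :=
  (LinearMap.range ((1 - star T * T : H →L[ℂ] H) : H →ₗ[ℂ] H)).topologicalClosure

end Operators

/-! ## The vectorial Hardy space and Toeplitz operators -/

section Hardy

variable {E : Type u} [NormedAddCommGroup E] [InnerProductSpace ℂ E]

/-- The Hardy space `H²(E)` of the power series `∑ zⁿ aₙ` on the unit disc with coefficients
`aₙ ∈ E` such that `∑ ‖aₙ‖² < ∞`; an element is given by its coefficients, and
`‖f‖² = ∑ ‖aₙ‖²`. -/
abbrev HardySpace (E : Type u) [NormedAddCommGroup E] : Type u := lp (fun _ : ℕ => E) 2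

/-- The value at `z` of the function on the unit disc given by an element of `H²(E)`. -/
noncomputable def hardyEval (f : HardySpace E) (z : ℂ) : E := ∑' n : ℕ, z ^ n • f n

theorem hardyEval_hasSum [CompleteSpace E] (f : HardySpace E) {z : ℂ} (hz : ‖z‖ < 1) :
    HasSum (fun n : ℕ => z ^ n • f n) (hardyEval f z) := by
  refine Summable.hasSum (Summable.of_norm_bounded (g := fun n : ℕ => ‖z‖ ^ n * ‖f‖)
    ((summable_geometric_of_lt_one (norm_nonneg z) hz).mul_right _) fun n => ?_)
  rw [norm_smul, norm_pow]
  exact mul_le_mul_of_nonneg_left (lp.norm_apply_le_norm (by norm_num) f n) (by positivity)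

/-- Multiplication of `H²(E)` by the constant operator `A`. -/
noncomputable def hardyConst (A : E →L[ℂ] E) : HardySpace E →L[ℂ] HardySpace E :=
  have bound : ∀ (f : HardySpace E) (s : Finset ℕ),
      ∑ n ∈ s, ‖A (f n)‖ ^ (2 : ℝ≥0∞).toReal ≤ (‖A‖ * ‖f‖) ^ (2 : ℝ≥0∞).toReal := by
    intro f s
    rw [Real.mul_rpow (norm_nonneg _) (norm_nonneg _)]
    refine le_trans ?_ (mul_le_mul_of_nonneg_left
      (lp.sum_rpow_le_norm_rpow (by norm_num) f s) (by positivity))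
    rw [Finset.mul_sum]
    refine Finset.sum_le_sum fun n _ => ?_
    rw [← Real.mul_rpow (norm_nonneg _) (norm_nonneg _)]
    exact Real.rpow_le_rpow (norm_nonneg _) (A.le_opNorm _) (by norm_num)
  LinearMap.mkContinuous
    { toFun := fun f => ⟨fun n => A (f n), memℓp_gen' (bound f)⟩
      map_add' := fun f g => by ext n; exact A.map_add (f n) (g n)
      map_smul' := fun c f => by ext n; simp }
    ‖A‖ fun f => lp.norm_le_of_forall_sum_le (by norm_num) (by positivity) (bound f)

theorem hardyConst_apply (A : E →L[ℂ] E) (f : HardySpace E) (n : ℕ) :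
    hardyConst A f n = A (f n) := rfl

/-- The coefficients of `z f(z)`. -/
def shiftCoeff (a : ℕ → E) : ℕ → E
  | 0 => 0
  | n + 1 => a n

/-- Multiplication of `H²(E)` by the variable `z`. -/
noncomputable def hardyShift : HardySpace E →L[ℂ] HardySpace E :=
  have bound : ∀ (f : HardySpace E) (s : Finset ℕ),
      ∑ n ∈ s, ‖shiftCoeff f n‖ ^ (2 : ℝ≥0∞).toReal ≤ (1 * ‖f‖) ^ (2 : ℝ≥0∞).toReal := by
    intro f s
    obtain ⟨N, hN⟩ := s.exists_nat_subset_range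
    refine le_trans (Finset.sum_le_sum_of_subset_of_nonneg
      (hN.trans (Finset.range_mono (Nat.le_succ N))) fun _ _ _ => by positivity) ?_
    rw [Finset.sum_range_succ', one_mul]
    simpa [shiftCoeff] using
      lp.sum_rpow_le_norm_rpow (p := 2) (by norm_num) f (Finset.range N)
  LinearMap.mkContinuous
    { toFun := fun f => ⟨shiftCoeff f, memℓp_gen' (bound f)⟩
      map_add' := fun f g => by
        ext n
        cases n with
        | zero => exact (add_zero (0 : E)).symm
        | succ n => rfl
      map_smul' := fun c f => by ext n; cases n <;> simp [shiftCoeff] }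
    1 fun f => lp.norm_le_of_forall_sum_le (by norm_num) (by positivity) (bound f)

theorem hardyShift_zero (f : HardySpace E) : hardyShift f 0 = 0 := rfl

theorem hardyShift_succ (f : HardySpace E) (n : ℕ) : hardyShift f (n + 1) = f n := rfl

/-- The Toeplitz operator `T_φ` on `H²(E)` with the analytic symbol `φ(z) = A + z B`, that is,
multiplication by `φ`. -/
noncomputable def toeplitz (A B : E →L[ℂ] E) : HardySpace E →L[ℂ] HardySpace E :=
  hardyConst A + hardyShift ∘L hardyConst B

/-- `T_φ` is multiplication by its symbol: `(T_φ f)(z) = φ(z) f(z)` on the unit disc. -/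
theorem hardyEval_toeplitz [CompleteSpace E] (A B : E →L[ℂ] E) (f : HardySpace E) {z : ℂ}
    (hz : ‖z‖ < 1) : hardyEval (toeplitz A B f) z = (A + z • B) (hardyEval f z) := by
  have hA := (hardyEval_hasSum f hz).mapL A
  have hB := ((hardyEval_hasSum f hz).mapL B).const_smul z
  have hS : HasSum (fun n : ℕ => z ^ n • hardyShift (hardyConst B f) n)
      (z • B (hardyEval f z)) := by
    rw [← hasSum_nat_add_iff' 1]
    simpa [hardyShift_zero, hardyShift_succ, hardyConst_apply, pow_succ', mul_smul] using hB
  have h := hA.add hS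
  have e : (fun n : ℕ => A (z ^ n • f n) + z ^ n • hardyShift (hardyConst B f) n) =
      fun n : ℕ => z ^ n • toeplitz A B f n := by
    funext n
    simp [toeplitz, hardyConst_apply, smul_add]
  rw [e] at h
  exact h.tsum_eq

/-- An element of `H²(E)` is determined by its values on the unit disc. -/
theorem hardyEval_injective [CompleteSpace E] {f g : HardySpace E}
    (h : ∀ z : ℂ, ‖z‖ < 1 → hardyEval f z = hardyEval g z) : f = g := by
  have key : ∀ f : HardySpace E, HasFPowerSeriesOnBall (hardyEval f)
      (fun n => ContinuousMultilinearMap.mkPiRing ℂ (Fin n) (f n)) 0 1 := by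
    intro f
    refine ⟨?_, by norm_num, fun {y} hy => ?_⟩
    · refine FormalMultilinearSeries.le_radius_of_bound (r := 1) _ ‖f‖ fun n => ?_
      simpa using lp.norm_apply_le_norm (by norm_num) f n
    · have : ‖y‖ < 1 := by
        rw [mem_eball_zero_iff, ← ofReal_norm, ENNReal.ofReal_lt_one] at hy
        exact hy
      simpa using hardyEval_hasSum f this
  have hg : HasFPowerSeriesOnBall (hardyEval f)
      (fun n => ContinuousMultilinearMap.mkPiRing ℂ (Fin n) (g n)) 0 1 := by
    refine (key g).congr fun z hz => (h z ?_).symm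
    rw [mem_eball_zero_iff, ← ofReal_norm, ENNReal.ofReal_lt_one] at hz
    exact hz
  have := (key f).hasFPowerSeriesAt.eq_formalMultilinearSeries hg.hasFPowerSeriesAt
  ext n
  simpa using congrArg (fun p : FormalMultilinearSeries ℂ ℂ E => p n fun _ => 1) this

end Hardy

/-!
The proof separates spectral theory, which turns the definitions of tetrablock-contractions,
-unitaries and -isometries into statements about unitaries and isometries, from the model theory
of Berger, Coburn and Lebow for commuting pairs of isometries.

Spectral theory. The bicommutant of a commuting set of operators is a commutative, inverse-closed
Banach algebra, so a non-invertible element of it is annihilated by a character `φ`, and `φ R` lies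
in the spectrum of `R` for every `R` (`exists_character_of_not_isUnit`). This serves three times.
* If `(A, B, P)` is a tetrablock-unitary, then `P` is unitary (`IsEUnitary.mem_unitary`): by
  Fuglede's theorem the bicommutant may be taken to contain the adjoints; a character with
  `φ P = c` gives a point `z = (φ A, φ B, c)`, and `z` is in the Taylor spectrum because
  surjectivity of the last Koszul map would make
  `(A - z₁)(A - z₁)* + (B - z₂)(B - z₂)* + (P - z₃)(P - z₃)*` invertible, while `φ` kills it.
* If `S`, `T` are commuting contractions and `q` has no zero in the closed tetrablock, then
  `q(S, T, S T)` is invertible, since the points `(a, b, a b)` with `|a|, |b| ≤ 1` are in the closed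
  tetrablock (`isUnit_polyCalc`).
* If `S`, `T` are commuting unitaries, then `p(S, T, S T) q(S, T, S T)⁻¹` is normal, so its norm is
  its spectral radius, which characters bound by the supremum of `|p / q|`.

Hence a pair of operators with a commuting unitary extension `(S', T')` is a triangular
tetrablock-isometry (`isTriangularEIsometry_of_unitary_extension`); its Taylor spectrum is found by
exhibiting a contracting homotopy of the Koszul complex off the points `(a, b, a b)`.

Model theory. The pairs `(A, B) = (Q^⊥ W, Q W)` are exactly those with
`A* A + B* B = 1 = A A* + B B*` and `A* B = 0 = A B*` (`IsBCLPair`); conversely `W = A + B` and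
`Q = B B*`. For such a pair the Laurent operators on `ℓ²(ℤ; E)` with symbols `A + z B` and
`B* + z A*` are unitaries whose product in either order is the bilateral shift. They extend the two Toeplitz operators, which gives one
implication; purity is that of the unilateral shift.

For the other implication, `V` is the restriction of a unitary, hence an isometry, and therefore so
are the contractions `V₁` and `V₂`. As `V` is pure, `h ↦ ((1 - V V*) V*ⁿ h)ₙ` is a unitary onto
`H²(𝒟_{V*})` (`woldIsometry`), and it carries `V₁` to the Toeplitz operator with symbol `A + z B`,
where `A* = V₁*` and `B = V₂*` restricted to `𝒟_{V*} = ker V*`.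
-/

/-! ### Characters of bicommutants -/

section Characters

variable {𝒜 : Type*} [NormedRing 𝒜] [NormedAlgebra ℂ 𝒜]

/-- Bicommutants are inverse-closed, so that invertibility and spectra may be computed in them. -/
theorem mem_bicommutant_of_mul_eq_one {s : Set 𝒜} {a b : 𝒜}
    (ha : a ∈ Subalgebra.centralizer ℂ s.centralizer) (hab : a * b = 1) (hba : b * a = 1) :
    b ∈ Subalgebra.centralizer ℂ s.centralizer := by
  rw [Subalgebra.mem_centralizer_iff] at ha ⊢
  intro g hg
  calc g * b = b * a * (g * b) := by rw [hba, one_mul]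
    _ = b * (g * a) * b := by rw [ha g hg]; simp only [mul_assoc]
    _ = b * g := by rw [mul_assoc, mul_assoc, hab, mul_one]

theorem bicommutant_subset_centralizer {s : Set 𝒜} (hs : ∀ a ∈ s, ∀ b ∈ s, Commute a b) {a : 𝒜}
    (ha : a ∈ Subalgebra.centralizer ℂ s.centralizer) : a ∈ s.centralizer :=
  Set.centralizer_subset (fun b hb => Set.mem_centralizer_iff.2 fun c hc => hs c hc b hb) ha

theorem mem_bicommutant {s : Set 𝒜} {a : 𝒜} (ha : a ∈ s) :
    a ∈ Subalgebra.centralizer ℂ s.centralizer :=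
  Subalgebra.mem_centralizer_iff ℂ |>.2 fun _ hg => (hg a ha).symm

theorem commute_of_mem_bicommutant {s : Set 𝒜} (hs : ∀ a ∈ s, ∀ b ∈ s, Commute a b) {a b : 𝒜}
    (ha : a ∈ Subalgebra.centralizer ℂ s.centralizer)
    (hb : b ∈ Subalgebra.centralizer ℂ s.centralizer) : Commute a b :=
  Set.mem_centralizer_iff.1 hb a (bicommutant_subset_centralizer hs ha)

theorem isStarNormal_of_mem_bicommutant [StarRing 𝒜] {s : Set 𝒜}
    (hs : ∀ a ∈ s, ∀ b ∈ s, Commute a b) (hstar : ∀ a ∈ s, star a ∈ s) {a : 𝒜}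
    (ha : a ∈ Subalgebra.centralizer ℂ s.centralizer) : IsStarNormal a := by
  refine ⟨commute_of_mem_bicommutant hs ?_ ha⟩
  rw [Subalgebra.mem_centralizer_iff] at ha ⊢
  intro g hg
  have := ha (star g) fun b hb => by
    simpa using congrArg star (hg (star b) (hstar b hb)).symm
  simpa using congrArg star this.symm

/-- A non-invertible element of the bicommutant of a commuting set is annihilated by a character of
the bicommutant. The values of a character lie in the spectra relative to the whole algebra, since
the bicommutant is inverse-closed. -/
theorem exists_character_of_not_isUnit [CompleteSpace 𝒜] {s : Set 𝒜}
    (hs : ∀ a ∈ s, ∀ b ∈ s, Commute a b)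
    {a : 𝒜} (ha : a ∈ Subalgebra.centralizer ℂ s.centralizer) (hu : ¬ IsUnit a) :
    ∃ φ : Subalgebra.centralizer ℂ s.centralizer →ₐ[ℂ] ℂ, φ ⟨a, ha⟩ = 0 ∧
      ∀ b : Subalgebra.centralizer ℂ s.centralizer, φ b ∈ spectrum ℂ (b : 𝒜) := by
  let D := Subalgebra.centralizer ℂ s.centralizer
  have hcl : IsClosed (D : Set 𝒜) := Set.isClosed_centralizer _
  have : CompleteSpace D := hcl.completeSpace_coe
  let _ : NormedCommRing D :=
    { (inferInstance : NormedRing D) with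
      mul_comm := fun x y => Subtype.ext (commute_of_mem_bicommutant hs x.2 y.2) }
  have inv : ∀ x : D, IsUnit (x : 𝒜) → IsUnit x := by
    rintro ⟨x, hx⟩ ⟨v, rfl⟩
    exact IsUnit.of_mul_eq_one
      ⟨(↑v⁻¹ : 𝒜), mem_bicommutant_of_mul_eq_one hx v.mul_inv v.inv_mul⟩ (Subtype.ext v.mul_inv)
  have hu' : ¬ IsUnit (⟨a, ha⟩ : D) := fun h => hu (h.map D.val)
  obtain ⟨f, hf⟩ := WeakDual.CharacterSpace.exists_apply_eq_zero hu'
  refine ⟨WeakDual.CharacterSpace.toAlgHom f, hf, fun b => ?_⟩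
  have h1 := AlgHom.apply_mem_spectrum (WeakDual.CharacterSpace.toAlgHom f) b
  rw [spectrum.mem_iff] at h1 ⊢
  exact fun h => h1 (inv _ h)

end Characters

/-! ### Polynomials in a commuting triple -/

section PolyCalc

variable {H : Type u} [NormedAddCommGroup H] [InnerProductSpace ℂ H]

theorem polyCalc_mem {D : Subalgebra ℂ (H →L[ℂ] H)} {A B P : H →L[ℂ] H} (hA : A ∈ D)
    (hB : B ∈ D) (hP : P ∈ D) (p : MvPolynomial (Fin 3) ℂ) : polyCalc p A B P ∈ D :=
  sum_mem fun _ _ => D.smul_mem (mul_mem (mul_mem (pow_mem hA _) (pow_mem hB _)) (pow_mem hP _)) _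

theorem algHom_polyCalc {D : Subalgebra ℂ (H →L[ℂ] H)} (φ : D →ₐ[ℂ] ℂ) {A B P : H →L[ℂ] H}
    (hA : A ∈ D) (hB : B ∈ D) (hP : P ∈ D) (p : MvPolynomial (Fin 3) ℂ) :
    φ ⟨polyCalc p A B P, polyCalc_mem hA hB hP p⟩ =
      p.eval ![φ ⟨A, hA⟩, φ ⟨B, hB⟩, φ ⟨P, hP⟩] := by
  have : (⟨polyCalc p A B P, polyCalc_mem hA hB hP p⟩ : D) =
      ∑ m ∈ p.support, p.coeff m • (⟨A, hA⟩ ^ m 0 * ⟨B, hB⟩ ^ m 1 * ⟨P, hP⟩ ^ m 2 : D) := by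
    ext1
    simp [polyCalc]
  rw [this, MvPolynomial.eval_eq', map_sum]
  refine Finset.sum_congr rfl fun m _ => ?_
  rw [show ∀ (c : ℂ) (x : D), φ (c • x) = c • φ x from φ.toLinearMap.map_smul, map_mul,
    map_mul, map_pow, map_pow, map_pow, Fin.prod_univ_three, smul_eq_mul]
  rfl

theorem pow_intertwine {K : Type*} [NormedAddCommGroup K] [InnerProductSpace ℂ K]
    {J : H →ₗᵢ[ℂ] K} {T : H →L[ℂ] H} {S : K →L[ℂ] K} (h : ∀ x, S (J x) = J (T x)) (n : ℕ) (x : H) :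
    (S ^ n) (J x) = J ((T ^ n) x) := by
  induction n generalizing x with
  | zero => rfl
  | succ n ih => rw [pow_succ, pow_succ]; exact (congrArg (S ^ n) (h x)).trans (ih _)

/-- Restricting a triple of operators to a joint invariant subspace, embedded by `J`, restricts its
polynomials. -/
theorem polyCalc_intertwine {K : Type*} [NormedAddCommGroup K] [InnerProductSpace ℂ K]
    {J : H →ₗᵢ[ℂ] K} {A B P : H →L[ℂ] H} {A' B' P' : K →L[ℂ] K} (hA : ∀ x, A' (J x) = J (A x))
    (hB : ∀ x, B' (J x) = J (B x)) (hP : ∀ x, P' (J x) = J (P x))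
    (p : MvPolynomial (Fin 3) ℂ) (x : H) :
    polyCalc p A' B' P' (J x) = J (polyCalc p A B P x) := by
  simp only [polyCalc, sum_apply, smul_apply, map_sum, map_smul]
  refine Finset.sum_congr rfl fun m _ => congrArg _ ?_
  change (A' ^ m 0) ((B' ^ m 1) ((P' ^ m 2) (J x))) = J ((A ^ m 0) ((B ^ m 1) ((P ^ m 2) x)))
  rw [pow_intertwine hP, pow_intertwine hB, pow_intertwine hA]

end PolyCalc

/-! ### The Koszul complex and the Taylor spectrum -/

section Koszul

variable {H : Type u} [NormedAddCommGroup H] [InnerProductSpace ℂ H]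

/-- If `X A + Y B + Z P = 1` with `X`, `Y`, `Z` commuting with `A`, `B`, `P`, then `X`, `Y`, `Z`
define a contracting homotopy of the Koszul complex of `(A, B, P)`. -/
theorem koszulExact_of_bezout {A B P X Y Z : H →L[ℂ] H}
    (h : ∀ T ∈ ({X, Y, Z} : Set (H →L[ℂ] H)), Commute T A ∧ Commute T B ∧ Commute T P)
    (hAB : Commute A B) (hAP : Commute A P) (hBP : Commute B P)
    (hone : X * A + Y * B + Z * P = 1) : KoszulExact A B P := by
  -- the commutation relations and the Bézout identity, evaluated at vectors
  have ap : ∀ {S T : H →L[ℂ] H}, Commute S T → ∀ v, S (T v) = T (S v) := fun h v =>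
    congrArg (fun R : H →L[ℂ] H => R v) h.eq
  have hX := h X (by simp)
  have hY := h Y (by simp)
  have hZ := h Z (by simp)
  have one : ∀ v, X (A v) + Y (B v) + Z (P v) = v := fun v =>
    congrArg (fun R : H →L[ℂ] H => R v) hone
  refine ⟨fun v w hvw => ?_, ?_, ?_, fun v => ⟨(Z v, -Y v, X v), ?_⟩⟩
  · simp only [koszul0, Prod.mk.injEq] at hvw
    rw [← one v, ← one w, hvw.1, hvw.2.1, hvw.2.2]
  · rintro ⟨x, y, z⟩
    constructor
    · simp only [koszul1, Prod.mk_eq_zero, sub_eq_zero]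
      rintro ⟨h1, h2, h3⟩
      refine ⟨X x + Y y + Z z, ?_⟩
      simp only [koszul0, map_add, Prod.mk.injEq]
      refine ⟨?_, ?_, ?_⟩
      · rw [← ap hX.1, ← ap hY.1, ← ap hZ.1, h1, h2, one]
      · rw [← ap hX.2.1, ← ap hY.2.1, ← ap hZ.2.1, ← h1, h3, one]
      · rw [← ap hX.2.2, ← ap hY.2.2, ← ap hZ.2.2, ← h2, ← h3, one]
    · rintro ⟨v, hv⟩
      simp only [koszul0, Prod.mk.injEq] at hv
      obtain ⟨rfl, rfl, rfl⟩ := hv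
      simp [koszul1, ap hAB v, ap hAP v, ap hBP v]
  · rintro ⟨x, y, z⟩
    constructor
    · intro h0
      have h0 : A z - B y + P x = 0 := h0
      refine ⟨(-Y x - Z y, X x - Z z, X y + Y z), ?_⟩
      simp only [koszul1, map_add, map_sub, map_neg, Prod.mk.injEq]
      simp only [← ap hX.1, ← ap hY.1, ← ap hZ.1, ← ap hX.2.1, ← ap hY.2.1, ← ap hZ.2.1,
        ← ap hX.2.2, ← ap hY.2.2, ← ap hZ.2.2]
      have hX0 := congrArg X h0
      have hY0 := congrArg Y h0
      have hZ0 := congrArg Z h0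
      simp only [map_add, map_sub, map_zero] at hX0 hY0 hZ0
      refine ⟨?_, ?_, ?_⟩
      · linear_combination (norm := module) one x - hZ0
      · linear_combination (norm := module) one y + hY0
      · linear_combination (norm := module) one z - hX0
    · rintro ⟨⟨a, b, c⟩, hv⟩
      simp only [koszul1, Prod.mk.injEq] at hv
      obtain ⟨rfl, rfl, rfl⟩ := hv
      simp only [koszul2, map_sub]
      rw [ap hAB c, ap hAP b, ap hBP a]
      abel
  · simp only [koszul2, map_neg, sub_neg_eq_add]
    rw [← ap hX.1, ← ap hY.2.1, ← ap hZ.2.2, one]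

/-- The Taylor spectrum of `(S, T, S T)` consists of points `(a, b, a b)` with `a`, `b` in the
spectra of `S`, `T`. At any other point `z` the ideal generated by `S - z₁`, `T - z₂`, `S T - z₃`
is the unit ideal. -/
theorem mem_taylorSpectrum_mul {S T : H →L[ℂ] H} (hST : Commute S T) {z : Fin 3 → ℂ}
    (hz : z ∈ taylorSpectrum S T (S * T)) :
    z 0 ∈ spectrum ℂ S ∧ z 1 ∈ spectrum ℂ T ∧ z 2 = z 0 * z 1 := by
  have cs : ∀ c : ℂ, ∀ R : H →L[ℂ] H, Commute (c • (1 : H →L[ℂ] H)) R := fun c R =>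
    (Commute.one_left R).smul_left c
  have cs' : ∀ c : ℂ, ∀ R : H →L[ℂ] H, Commute R (c • (1 : H →L[ℂ] H)) := fun c R =>
    (Commute.one_right R).smul_right c
  have c0 : ∀ {R R' : H →L[ℂ] H} (c d : ℂ), Commute R R' → Commute (R - c • 1) (R' - d • 1) :=
    fun c d h => (h.sub_left (cs _ _)).sub_right (cs' _ _)
  have hSP : Commute S (S * T) := (Commute.refl S).mul_right hST
  have hTP : Commute T (S * T) := hST.symm.mul_right (Commute.refl T)
  have key := fun X Y Z h => mt (koszulExact_of_bezout (X := X) (Y := Y) (Z := Z) h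
    (c0 (z 0) (z 1) hST) (c0 (z 0) (z 2) hSP) (c0 (z 1) (z 2) hTP)) hz
  have hinv : ∀ {R : H →L[ℂ] H} {c : ℂ}, c ∉ spectrum ℂ R → ∃ X, X * (R - c • 1) = 1 ∧
      ∀ R', Commute (R - c • 1) R' → Commute X R' := by
    intro R c h
    rw [spectrum.notMem_iff, ← IsUnit.neg_iff, neg_sub, Algebra.algebraMap_eq_smul_one] at h
    obtain ⟨v, hv⟩ := h
    rw [← hv]
    exact ⟨_, v.inv_mul, fun R' h => h.units_inv_left⟩
  refine ⟨?_, ?_, ?_⟩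
  · by_contra hn
    obtain ⟨X, hX, hX'⟩ := hinv hn
    refine key X 0 0 ?_ (by simp [hX])
    rintro R (rfl | rfl | rfl)
    · exact ⟨hX' _ (Commute.refl _), hX' _ (c0 _ _ hST), hX' _ (c0 _ _ hSP)⟩
    all_goals exact ⟨Commute.zero_left _, Commute.zero_left _, Commute.zero_left _⟩
  · by_contra hn
    obtain ⟨Y, hY, hY'⟩ := hinv hn
    refine key 0 Y 0 ?_ (by simp [hY])
    rintro R (rfl | rfl | rfl)
    · exact ⟨Commute.zero_left _, Commute.zero_left _, Commute.zero_left _⟩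
    · exact ⟨hY' _ (c0 _ _ hST.symm), hY' _ (Commute.refl _), hY' _ (c0 _ _ hTP)⟩
    · exact ⟨Commute.zero_left _, Commute.zero_left _, Commute.zero_left _⟩
  · by_contra hn
    have hc : z 0 * z 1 - z 2 ≠ 0 := sub_ne_zero.2 (Ne.symm hn)
    set c := z 0 * z 1 - z 2
    -- `c = (S T - z₃) - T (S - z₁) - z₁ (T - z₂)` is a nonzero scalar
    refine key ((-c⁻¹) • T) ((-c⁻¹ * z 0) • 1) (c⁻¹ • 1) ?_ ?_
    · rintro R (rfl | rfl | rfl)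
      · exact ⟨((hST.symm.sub_right (cs' _ _))).smul_left _,
          ((Commute.refl T).sub_right (cs' _ _)).smul_left _,
          (hTP.sub_right (cs' _ _)).smul_left _⟩
      all_goals exact ⟨cs _ _, cs _ _, cs _ _⟩
    · have : (-c⁻¹) • T * (S - z 0 • 1) + (-c⁻¹ * z 0) • (1 : H →L[ℂ] H) * (T - z 1 • 1) +
          c⁻¹ • (1 : H →L[ℂ] H) * (S * T - z 2 • 1) = (c⁻¹ * c) • (1 : H →L[ℂ] H) := by
        rw [hST.eq]
        simp only [mul_sub, smul_mul_assoc, mul_smul_comm, mul_one, one_mul, c, sub_smul]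
        module
      rw [this, inv_mul_cancel₀ hc, one_smul]

/-- If the last map of the Koszul complex is onto, the open mapping theorem bounds
`‖A* x‖ + ‖B* x‖ + ‖P* x‖` below by a multiple of `‖x‖`. -/
theorem isUnit_of_koszul2_surjective [CompleteSpace H] {A B P : H →L[ℂ] H}
    (h : Function.Surjective (koszul2 A B P)) :
    IsUnit (A * star A + B * star B + P * star P) := by
  -- `koszul2 A B P` as a bounded operator
  let R : H × H × H →L[ℂ] H :=
    A ∘L .snd ℂ H H ∘L .snd ℂ H (H × H) - B ∘L .fst ℂ H H ∘L .snd ℂ H (H × H) +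
      P ∘L .fst ℂ H (H × H)
  obtain ⟨C, hC, hR⟩ := R.exists_preimage_norm_le h
  lift C to NNReal using hC.le
  refine ContinuousLinearMap.isUnit_of_forall_le_norm_inner_map _
    (c := (3 * C ^ 2)⁻¹) (by have : 0 < C := hC; positivity) fun x => ?_
  have hin : inner ℂ ((A * star A + B * star B + P * star P) x) x =
      ((‖star A x‖ ^ 2 + ‖star B x‖ ^ 2 + ‖star P x‖ ^ 2 : ℝ) : ℂ) := by
    have hT : ∀ T : H →L[ℂ] H, inner ℂ (T (star T x)) x = ((‖star T x‖ ^ 2 : ℝ) : ℂ) := by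
      intro T
      rw [← ContinuousLinearMap.adjoint_inner_right, ← ContinuousLinearMap.star_eq_adjoint,
        inner_self_eq_norm_sq_to_K]
      simp
    simp only [add_apply, inner_add_left]
    refine (congrArg₂ _ (congrArg₂ _ (hT A) (hT B)) (hT P)).trans ?_
    push_cast
    rfl
  obtain ⟨⟨u, v, w⟩, huvw, hle⟩ := hR x
  have hu : ‖u‖ ≤ C * ‖x‖ := (norm_fst_le (u, v, w)).trans hle
  have hv : ‖v‖ ≤ C * ‖x‖ := ((norm_fst_le (v, w)).trans (norm_snd_le (u, v, w))).trans hle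
  have hw : ‖w‖ ≤ C * ‖x‖ := ((norm_snd_le (v, w)).trans (norm_snd_le (u, v, w))).trans hle
  have hx : ‖x‖ ^ 2 ≤ C * ‖x‖ * (‖star A x‖ + ‖star B x‖ + ‖star P x‖) := by
    have h1 : ((‖x‖ ^ 2 : ℝ) : ℂ) =
        inner ℂ (star A x) w - inner ℂ (star B x) v + inner ℂ (star P x) u := by
      simp only [ContinuousLinearMap.star_eq_adjoint, ContinuousLinearMap.adjoint_inner_left]
      rw [← inner_sub_right, ← inner_add_right]
      have : A w - B v + P u = x := huvw
      rw [this, inner_self_eq_norm_sq_to_K]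
      simp
    have h2 := congrArg norm h1
    rw [Complex.norm_real, Real.norm_of_nonneg (by positivity)] at h2
    rw [h2]
    refine (norm_add_le _ _).trans ((add_le_add_left (norm_sub_le _ _) _).trans ?_)
    have i1 := (norm_inner_le_norm (𝕜 := ℂ) (star A x) w).trans
      (mul_le_mul_of_nonneg_left hw (norm_nonneg _))
    have i2 := (norm_inner_le_norm (𝕜 := ℂ) (star B x) v).trans
      (mul_le_mul_of_nonneg_left hv (norm_nonneg _))
    have i3 := (norm_inner_le_norm (𝕜 := ℂ) (star P x) u).trans
      (mul_le_mul_of_nonneg_left hu (norm_nonneg _))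
    linarith
  rw [hin, Complex.norm_real, Real.norm_of_nonneg (by positivity)]
  push_cast
  rw [← div_eq_mul_inv, div_le_iff₀ (by have : (0 : ℝ) < C := hC; positivity)]
  set a := ‖star A x‖
  set b := ‖star B x‖
  set p := ‖star P x‖
  rcases (norm_nonneg x).eq_or_lt with h0 | h0
  · rw [← h0, zero_pow two_ne_zero]; positivity
  have hx' : ‖x‖ ≤ C * (a + b + p) := by
    refine le_of_mul_le_mul_left ?_ h0
    linarith
  have h3 : (a + b + p) ^ 2 ≤ 3 * (a ^ 2 + b ^ 2 + p ^ 2) := by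
    nlinarith [sq_nonneg (a - b), sq_nonneg (b - p), sq_nonneg (a - p)]
  calc ‖x‖ ^ 2 ≤ (C * (a + b + p)) ^ 2 := by gcongr
    _ = C ^ 2 * (a + b + p) ^ 2 := by ring
    _ ≤ C ^ 2 * (3 * (a ^ 2 + b ^ 2 + p ^ 2)) := by gcongr
    _ = _ := by ring

end Koszul

/-! ### The closed tetrablock -/

section Tetrablock

open scoped Matrix.Norms.L2Operator in
/-- `(a, b, a b)` is the point given by the diagonal matrix with entries `a`, `b`, a limit of
diagonal matrices of norm less than `1`. -/
theorem mem_closedTetrablock_of_norm_le_one {a b : ℂ} (ha : ‖a‖ ≤ 1) (hb : ‖b‖ ≤ 1) :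
    ![a, b, a * b] ∈ closedTetrablock := by
  have hlim : Filter.Tendsto (fun r : ℝ => ![(r : ℂ) * a, r * b, r * a * (r * b)])
      (nhdsWithin 1 (Set.Iio 1)) (nhds ![a, b, a * b]) := by
    have : Continuous (fun r : ℝ => ![(r : ℂ) * a, r * b, r * a * (r * b)]) := by fun_prop
    simpa using (this.tendsto 1).mono_left nhdsWithin_le_nhds
  refine mem_closure_of_tendsto hlim ?_
  filter_upwards [Ioo_mem_nhdsLT (zero_lt_one' ℝ)] with r hr
  refine ⟨Matrix.diagonal ![r * a, r * b], ?_, ?_⟩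
  · refine lt_of_eq_of_lt (Matrix.l2_opNorm_toEuclideanCLM _) ?_
    rw [Matrix.l2_opNorm_diagonal, pi_norm_lt_iff one_pos]
    intro i
    fin_cases i <;> simp [abs_of_pos hr.1] <;> nlinarith [hr.1, hr.2, norm_nonneg a, norm_nonneg b]
  · simp

open scoped Matrix.Norms.L2Operator in
theorem isCompact_closedTetrablock : IsCompact closedTetrablock := by
  refine Bornology.IsBounded.isCompact_closure ?_
  refine (Metric.isBounded_closedBall (x := 0) (r := 2)).subset ?_
  rintro _ ⟨A, hA, rfl⟩
  -- entries of a matrix are bounded by its norm, so the determinant has modulus at most `2`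
  have hent : ∀ i j, ‖A i j‖ ≤ 1 := by
    intro i j
    have h1 := (Matrix.toEuclideanCLM (n := Fin 2) (𝕜 := ℂ) A).le_opNorm
      (EuclideanSpace.single j 1)
    have h2 := PiLp.norm_apply_le (Matrix.toEuclideanCLM (n := Fin 2) (𝕜 := ℂ) A
      (EuclideanSpace.single j 1)) i
    have h3 : Matrix.toEuclideanCLM (n := Fin 2) (𝕜 := ℂ) A
      (EuclideanSpace.single j 1) i = A i j := by
      simp
    rw [h3] at h2
    simp at h1
    linarith
  rw [mem_closedBall_zero_iff, pi_norm_le_iff_of_nonneg zero_le_two]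
  intro i
  fin_cases i
  · exact (hent 0 0).trans one_le_two
  · exact (hent 1 1).trans one_le_two
  · simp only [Matrix.det_fin_two]
    refine (norm_sub_le _ _).trans ?_
    rw [norm_mul, norm_mul]
    have := mul_le_one₀ (hent 0 0) (norm_nonneg _) (hent 1 1)
    have := mul_le_one₀ (hent 0 1) (norm_nonneg _) (hent 1 0)
    linarith

end Tetrablock

/-! ### Commuting contractions, unitary extensions and tetrablock-unitaries -/

section Contraction

variable {H : Type u} [NormedAddCommGroup H] [InnerProductSpace ℂ H] [CompleteSpace H]

theorem norm_le_of_mem_spectrum {T : H →L[ℂ] H} {c : ℂ} (hT : ‖T‖ ≤ 1) (hc : c ∈ spectrum ℂ T) :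
    ‖c‖ ≤ 1 :=
  (spectrum.norm_le_norm_mul_of_mem hc).trans
    (mul_le_one₀ hT (norm_nonneg _) ContinuousLinearMap.norm_id_le)

theorem norm_le_one_of_mem_unitary {T : H →L[ℂ] H} (hT : T ∈ unitary (H →L[ℂ] H)) : ‖T‖ ≤ 1 := by
  have h : ‖star T * T‖ ≤ 1 := by
    rw [Unitary.star_mul_self_of_mem hT]
    exact ContinuousLinearMap.norm_id_le
  rw [CStarRing.norm_star_mul_self] at h
  nlinarith [norm_nonneg T]

theorem bddAbove_norm_eval_div {p q : MvPolynomial (Fin 3) ℂ}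
    (hq : ∀ z ∈ closedTetrablock, q.eval z ≠ 0) :
    BddAbove ((fun z : Fin 3 → ℂ => ‖p.eval z / q.eval z‖) '' closedTetrablock) :=
  (isCompact_closedTetrablock.image_of_continuousOn
    ((MvPolynomial.continuous_eval p).continuousOn.div
      (MvPolynomial.continuous_eval q).continuousOn hq).norm).bddAbove

theorem commute_pair {H : Type*} [NormedAddCommGroup H] [InnerProductSpace ℂ H]
    {S T : H →L[ℂ] H} (hST : Commute S T) :
    ∀ a ∈ ({S, T} : Set (H →L[ℂ] H)), ∀ b ∈ ({S, T} : Set (H →L[ℂ] H)), Commute a b := by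
  rintro a (rfl | rfl) b (rfl | rfl)
  exacts [Commute.refl _, hST, hST.symm, Commute.refl _]

theorem isUnit_polyCalc {S T : H →L[ℂ] H} (hST : Commute S T) (hS : ‖S‖ ≤ 1) (hT : ‖T‖ ≤ 1)
    {q : MvPolynomial (Fin 3) ℂ} (hq : ∀ z ∈ closedTetrablock, q.eval z ≠ 0) :
    IsUnit (polyCalc q S T (S * T)) := by
  by_contra hu
  have hS' := mem_bicommutant (s := {S, T}) (Set.mem_insert S _)
  have hT' := mem_bicommutant (s := {S, T}) (Set.mem_insert_of_mem S rfl)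
  obtain ⟨φ, hφ, hspec⟩ := exists_character_of_not_isUnit (commute_pair hST)
    (polyCalc_mem hS' hT' (mul_mem hS' hT') q) hu
  rw [algHom_polyCalc φ hS' hT' (mul_mem hS' hT')] at hφ
  have hmul : φ ⟨S * T, mul_mem hS' hT'⟩ = φ ⟨S, hS'⟩ * φ ⟨T, hT'⟩ := map_mul φ ⟨S, hS'⟩ ⟨T, hT'⟩
  rw [hmul] at hφ
  exact hq _ (mem_closedTetrablock_of_norm_le_one (norm_le_of_mem_spectrum hS (hspec ⟨S, hS'⟩))
    (norm_le_of_mem_spectrum hT (hspec ⟨T, hT'⟩))) hφ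

/-- The von Neumann inequality for `(S, T, S T)` with commuting unitaries `S`, `T`: the operator on
the left is normal, and characters of the bicommutant of `{S, T, S*, T*}` describe its spectrum. -/
theorem norm_polyCalc_mul_inverse_le_of_unitary {S T : H →L[ℂ] H} (hST : Commute S T)
    (hS : S ∈ unitary (H →L[ℂ] H)) (hT : T ∈ unitary (H →L[ℂ] H))
    (p : MvPolynomial (Fin 3) ℂ) {q : MvPolynomial (Fin 3) ℂ}
    (hq : ∀ z ∈ closedTetrablock, q.eval z ≠ 0) :
    ‖polyCalc p S T (S * T) * Ring.inverse (polyCalc q S T (S * T))‖ ≤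
      sSup ((fun z : Fin 3 → ℂ => ‖p.eval z / q.eval z‖) '' closedTetrablock) := by
  set s : Set (H →L[ℂ] H) := {S, T, star S, star T} with hs_def
  have hSn : IsStarNormal S := isStarNormal_of_mem_unitary hS
  have hTn : IsStarNormal T := isStarNormal_of_mem_unitary hT
  have h1 : Commute (star S) T := hSn.commute_star_left hST
  have h2 : Commute S (star T) := hTn.commute_star_right hST
  have hs : ∀ a ∈ s, ∀ b ∈ s, Commute a b := by
    rintro a (rfl | rfl | rfl | rfl) b (rfl | rfl | rfl | rfl)
    exacts [.refl _, hST, hSn.star_comm_self.symm, h2, hST.symm, .refl _, h1.symm,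
      hTn.star_comm_self.symm, hSn.star_comm_self, h1, .refl _, hST.star_star, h2.symm,
      hTn.star_comm_self, hST.symm.star_star, .refl _]
  have hstar : ∀ a ∈ s, star a ∈ s := by
    rintro a (rfl | rfl | rfl | rfl) <;> simp [hs_def]
  have hS' : S ∈ Subalgebra.centralizer ℂ s.centralizer := mem_bicommutant (by simp [hs_def])
  have hT' : T ∈ Subalgebra.centralizer ℂ s.centralizer := mem_bicommutant (by simp [hs_def])
  have hp' := polyCalc_mem hS' hT' (mul_mem hS' hT') p
  have hq' := polyCalc_mem hS' hT' (mul_mem hS' hT') q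
  have hnS : ‖S‖ ≤ 1 := norm_le_one_of_mem_unitary hS
  have hnT : ‖T‖ ≤ 1 := norm_le_one_of_mem_unitary hT
  have hu := isUnit_polyCalc hST hnS hnT hq
  have hi' := mem_bicommutant_of_mul_eq_one hq' (Ring.mul_inverse_cancel _ hu)
    (Ring.inverse_mul_cancel _ hu)
  have hmul : ∀ φ : Subalgebra.centralizer ℂ s.centralizer →ₐ[ℂ] ℂ,
      φ ⟨S * T, mul_mem hS' hT'⟩ = φ ⟨S, hS'⟩ * φ ⟨T, hT'⟩ := fun φ => map_mul φ ⟨S, hS'⟩ ⟨T, hT'⟩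
  have hinv : ∀ φ : Subalgebra.centralizer ℂ s.centralizer →ₐ[ℂ] ℂ,
      φ ⟨_, hq'⟩ * φ ⟨_, hi'⟩ = 1 := fun φ => by
    rw [← map_mul, ← map_one φ]
    exact congrArg φ (Subtype.ext (Ring.mul_inverse_cancel _ hu))
  have ha := mul_mem hp' hi'
  set a := polyCalc p S T (S * T) * Ring.inverse (polyCalc q S T (S * T)) with ha_def
  have : IsStarNormal a := isStarNormal_of_mem_bicommutant hs hstar ha
  set M := sSup ((fun z : Fin 3 → ℂ => ‖p.eval z / q.eval z‖) '' closedTetrablock)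
  have hM : 0 ≤ M := Real.sSup_nonneg (by rintro _ ⟨z, -, rfl⟩; exact norm_nonneg _)
  have hspec : ∀ c ∈ spectrum ℂ a, ‖c‖ ≤ M := by
    intro c hc
    rw [spectrum.mem_iff] at hc
    obtain ⟨φ, hφ, hsp⟩ := exists_character_of_not_isUnit hs
      (sub_mem (Subalgebra.algebraMap_mem _ c) ha) hc
    have hφa : φ ⟨a, ha⟩ = c := by
      have : φ (algebraMap ℂ _ c - ⟨a, ha⟩) = 0 := hφ
      rw [map_sub, AlgHom.commutes, sub_eq_zero] at this
      exact this.symm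
    have hφa' : φ ⟨a, ha⟩ = φ ⟨_, hp'⟩ * φ ⟨_, hi'⟩ := map_mul φ ⟨_, hp'⟩ ⟨_, hi'⟩
    have hdiv : c = φ ⟨_, hp'⟩ / φ ⟨_, hq'⟩ := by
      rw [eq_div_iff (left_ne_zero_of_mul_eq_one (hinv φ)), ← hφa, hφa', mul_assoc,
        mul_comm (φ ⟨_, hi'⟩), hinv, mul_one]
    rw [hdiv, algHom_polyCalc φ hS' hT' (mul_mem hS' hT'),
      algHom_polyCalc φ hS' hT' (mul_mem hS' hT'), hmul]
    exact le_csSup (bddAbove_norm_eval_div hq) ⟨_, mem_closedTetrablock_of_norm_le_one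
      (norm_le_of_mem_spectrum hnS (hsp ⟨S, hS'⟩)) (norm_le_of_mem_spectrum hnT (hsp ⟨T, hT'⟩)),
      rfl⟩
  have hr : spectralRadius ℂ a ≤ ENNReal.ofReal M := iSup₂_le fun c hc => by
    rw [← enorm_eq_nnnorm, ← ofReal_norm]
    exact ENNReal.ofReal_le_ofReal (hspec c hc)
  rw [IsStarNormal.spectralRadius_eq_nnnorm, ← enorm_eq_nnnorm, ← ofReal_norm,
    ENNReal.ofReal_le_ofReal_iff hM] at hr
  exact hr

/-- Commuting operators that extend to commuting unitaries form a triangular tetrablock-isometry.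
The von Neumann inequality is inherited from the extension once `q(S, T, S T)` is known to be
invertible. -/
theorem isTriangularEIsometry_of_unitary_extension {K : Type u} [NormedAddCommGroup K]
    [InnerProductSpace ℂ K] [CompleteSpace K] (J : H →ₗᵢ[ℂ] K) {S T : H →L[ℂ] H}
    {S' T' : K →L[ℂ] K} (hS : S' ∈ unitary (K →L[ℂ] K)) (hT : T' ∈ unitary (K →L[ℂ] K))
    (hc : Commute S' T') (hJS : ∀ h, S' (J h) = J (S h)) (hJT : ∀ h, T' (J h) = J (T h)) :
    IsTriangularEIsometry S T (S * T) := by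
  have hnS' : ‖S'‖ ≤ 1 := norm_le_one_of_mem_unitary hS
  have hnT' : ‖T'‖ ≤ 1 := norm_le_one_of_mem_unitary hT
  have hST : Commute S T := by
    ext h
    refine J.injective ?_
    change J (S (T h)) = J (T (S h))
    rw [← hJS, ← hJT, ← hJT, ← hJS]
    exact congrArg (fun R : K →L[ℂ] K => R (J h)) hc.eq
  have hJP : ∀ h, (S' * T') (J h) = J ((S * T) h) := fun h =>
    (congrArg S' (hJT h)).trans (hJS _)
  have hn : ∀ {R : H →L[ℂ] H} {R' : K →L[ℂ] K}, ‖R'‖ ≤ 1 → (∀ h, R' (J h) = J (R h)) →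
      ‖R‖ ≤ 1 := fun {R R'} hR' hJ => R.opNorm_le_bound zero_le_one fun h => by
    rw [← J.norm_map (R h), ← hJ, one_mul, ← J.norm_map h]
    exact R'.le_of_opNorm_le_of_le hR' le_rfl |>.trans (one_mul _).le
  have hnS := hn hnS' hJS
  have hnT := hn hnT' hJT
  have hcomm : ∀ {L : Type u} [NormedAddCommGroup L] [InnerProductSpace ℂ L] {A B : L →L[ℂ] L},
      Commute A B → CommutingTriple A B (A * B) := fun h =>
    ⟨h, (Commute.refl _).mul_right h, h.symm.mul_right (Commute.refl _)⟩
  refine ⟨⟨hcomm hST, ?_, fun p q hq => ⟨isUnit_polyCalc hST hnS hnT hq, ?_⟩⟩,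
    ⟨hcomm hST, K, _, _, ‹_›, J, S', T', S' * T', ⟨hcomm hc, isStarNormal_of_mem_unitary hS,
      isStarNormal_of_mem_unitary hT, isStarNormal_of_mem_unitary (mul_mem hS hT), ?_⟩,
      fun h => ⟨hJS h, hJT h, hJP h⟩⟩, S, T, hST, hnS, hnT, rfl, rfl, rfl⟩
  · intro z hz
    obtain ⟨h0, h1, h2⟩ := mem_taylorSpectrum_mul hST hz
    have : z = ![z 0, z 1, z 0 * z 1] := by ext i; fin_cases i <;> simp [h2]
    rw [this]
    exact mem_closedTetrablock_of_norm_le_one (norm_le_of_mem_spectrum hnS h0)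
      (norm_le_of_mem_spectrum hnT h1)
  · have hu := isUnit_polyCalc hST hnS hnT hq
    have hu' := isUnit_polyCalc hc hnS' hnT' hq
    refine le_trans (ContinuousLinearMap.opNorm_le_bound _ (norm_nonneg _) fun h => ?_)
      (norm_polyCalc_mul_inverse_le_of_unitary hc hS hT p hq)
    -- `J` carries `q(S, T, S T)⁻¹ h` to `q(S', T', S' T')⁻¹ (J h)`
    set g := Ring.inverse (polyCalc q S T (S * T)) h
    have hg : polyCalc q S T (S * T) g = h :=
      congrArg (fun R : H →L[ℂ] H => R h) (Ring.mul_inverse_cancel _ hu)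
    have hJg : J g = Ring.inverse (polyCalc q S' T' (S' * T')) (J h) := by
      rw [← hg, ← polyCalc_intertwine hJS hJT hJP]
      exact (congrArg (fun R : K →L[ℂ] K => R (J g)) (Ring.inverse_mul_cancel _ hu')).symm
    rw [← J.norm_map h]
    change ‖polyCalc p S T (S * T) g‖ ≤ _
    rw [← J.norm_map, ← polyCalc_intertwine hJS hJT hJP, hJg]
    exact ContinuousLinearMap.le_opNorm (polyCalc p S' T' (S' * T') *
      Ring.inverse (polyCalc q S' T' (S' * T'))) (J h)
  · intro z hz
    obtain ⟨h0, h1, h2⟩ := mem_taylorSpectrum_mul hc hz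
    have : z = ![z 0, z 1, z 0 * z 1] := by ext i; fin_cases i <;> simp [h2]
    refine ⟨?_, ?_⟩
    · rw [this]
      exact mem_closedTetrablock_of_norm_le_one (norm_le_of_mem_spectrum hnS' h0)
        (norm_le_of_mem_spectrum hnT' h1)
    · rw [h2, norm_mul, spectrum.norm_eq_one_of_unitary hS h0,
        spectrum.norm_eq_one_of_unitary hT h1, one_mul]

/-- The spectrum of `P` is contained in the projection of the Taylor spectrum of `(A, B, P)` to the
third coordinate, hence in the unit circle. -/
theorem IsEUnitary.mem_unitary {A B P : H →L[ℂ] H} (h : IsEUnitary A B P) :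
    P ∈ unitary (H →L[ℂ] H) := by
  have hA := h.normal_A
  have hB := h.normal_B
  have hP := h.normal_P
  have cAB := h.comm.comm_AB
  have cAP := h.comm.comm_AP
  have cBP := h.comm.comm_BP
  set s : Set (H →L[ℂ] H) := {R | R ∈ ({A, B, P} : Set _) ∨ star R ∈ ({A, B, P} : Set _)}
    with hs_def
  have h0 : ∀ a ∈ ({A, B, P} : Set (H →L[ℂ] H)), IsStarNormal a ∧
      ∀ b ∈ ({A, B, P} : Set (H →L[ℂ] H)), Commute a b := by
    rintro a (rfl | rfl | rfl)
    · exact ⟨hA, by rintro b (rfl | rfl | rfl); exacts [.refl _, cAB, cAP]⟩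
    · exact ⟨hB, by rintro b (rfl | rfl | rfl); exacts [cAB.symm, .refl _, cBP]⟩
    · exact ⟨hP, by rintro b (rfl | rfl | rfl); exacts [cAP.symm, cBP.symm, .refl _]⟩
  -- Fuglede's theorem makes the set of the three operators and their adjoints commutative
  have hs : ∀ a ∈ s, ∀ b ∈ s, Commute a b := by
    rintro a (ha | ha) b (hb | hb)
    · exact (h0 a ha).2 b hb
    · simpa using (h0 _ hb).1.commute_star_right ((h0 a ha).2 _ hb)
    · simpa using (h0 _ ha).1.commute_star_left ((h0 _ ha).2 b hb)
    · simpa using ((h0 _ ha).2 _ hb).star_star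
  have mem : ∀ {R}, R ∈ ({A, B, P} : Set (H →L[ℂ] H)) →
      R ∈ Subalgebra.centralizer ℂ s.centralizer ∧
      star R ∈ Subalgebra.centralizer ℂ s.centralizer := fun hR =>
    ⟨mem_bicommutant (Or.inl hR), mem_bicommutant (Or.inr (by rwa [star_star]))⟩
  obtain ⟨mA, mA'⟩ := mem (R := A) (by simp)
  obtain ⟨mB, mB'⟩ := mem (R := B) (by simp)
  obtain ⟨mP, mP'⟩ := mem (R := P) (by simp)
  refine mem_unitary_of_spectrum_subset_unitary fun c hc => ?_
  rw [spectrum.mem_iff] at hc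
  obtain ⟨φ, hφ, hsp⟩ := exists_character_of_not_isUnit hs
    (sub_mem (Subalgebra.algebraMap_mem _ c) mP) hc
  have hφP : φ ⟨P, mP⟩ = c := by
    have : φ (algebraMap ℂ _ c - ⟨P, mP⟩) = 0 := hφ
    rw [map_sub, AlgHom.commutes, sub_eq_zero] at this
    exact this.symm
  have hz : ![φ ⟨A, mA⟩, φ ⟨B, mB⟩, φ ⟨P, mP⟩] ∈ taylorSpectrum A B P := by
    intro hex
    have hu := isUnit_of_koszul2_surjective hex.surjective
    have hk : ∀ {R} (m : R ∈ Subalgebra.centralizer ℂ s.centralizer)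
        (m' : star R ∈ Subalgebra.centralizer ℂ s.centralizer),
        ∃ x : Subalgebra.centralizer ℂ s.centralizer, φ x = 0 ∧
          (x : H →L[ℂ] H) = (R - φ ⟨R, m⟩ • 1) * star (R - φ ⟨R, m⟩ • 1) := by
      intro R m m'
      refine ⟨(⟨R, m⟩ - algebraMap ℂ _ (φ ⟨R, m⟩)) *
        (⟨star R, m'⟩ - algebraMap ℂ _ (star (φ ⟨R, m⟩))), ?_, ?_⟩
      · rw [map_mul, map_sub, AlgHom.commutes, Algebra.algebraMap_self_apply, sub_self, zero_mul]
      · rw [star_sub, star_smul, star_one, ← Algebra.algebraMap_eq_smul_one,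
          ← Algebra.algebraMap_eq_smul_one]
        rfl
    obtain ⟨x, hx, hxA⟩ := hk mA mA'
    obtain ⟨y, hy, hyB⟩ := hk mB mB'
    obtain ⟨w, hw, hwP⟩ := hk mP mP'
    have hadd : ∀ u v, φ (u + v) = φ u + φ v := φ.toRingHom.map_add
    have h0 := hsp (x + y + w)
    rw [hadd, hadd, hx, hy, hw, add_zero, add_zero] at h0
    refine spectrum.zero_notMem ℂ ?_ h0
    have : ((x + y + w : Subalgebra.centralizer ℂ s.centralizer) : H →L[ℂ] H) = x + y + w := rfl
    rw [this, hxA, hyB, hwP]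
    exact hu
  have hc1 : ‖c‖ = 1 := hφP ▸ (h.spectrum_subset hz).2
  rw [SetLike.mem_coe, Unitary.mem_iff_star_mul_self]
  simp [Complex.conj_mul', hc1]

end Contraction

/-! ### Laurent operators on the bilateral sequence space -/

section Bilateral

variable {E : Type u} [NormedAddCommGroup E] [InnerProductSpace ℂ E]

theorem hasSum_norm_sq_lp {E : Type*} [NormedAddCommGroup E] {ι : Type*}
    (f : lp (fun _ : ι => E) 2) :
    HasSum (fun i => ‖f i‖ ^ 2) (‖f‖ ^ 2) := by
  simpa using lp.hasSum_norm (p := 2) (by norm_num) f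

theorem memℓp_two_of_hasSum {E : Type*} [NormedAddCommGroup E] {ι : Type*} {f : ι → E} {c : ℝ}
    (h : HasSum (fun i => ‖f i‖ ^ 2) c) : Memℓp f 2 :=
  memℓp_gen (by simpa using h.summable)

/-- The isometric embedding of `ℓ²(ι; E)` into `ℓ²(κ; E)` along an injection `e : ι ↪ κ`:
coefficients are transported by `e` and extended by zero. -/
noncomputable def lpExtend {ι κ : Type*} (e : ι ↪ κ) :
    lp (fun _ : ι => E) 2 →ₗᵢ[ℂ] lp (fun _ : κ => E) 2 :=
  have key : ∀ f : lp (fun _ : ι => E) 2,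
      HasSum (fun k => ‖Function.extend e f 0 k‖ ^ 2) (‖f‖ ^ 2) := by
    intro f
    have : (fun k => ‖Function.extend e f 0 k‖ ^ 2) =
        Function.extend e (fun i => ‖f i‖ ^ 2) 0 := by
      ext k
      by_cases hk : ∃ i, e i = k
      · obtain ⟨i, rfl⟩ := hk
        simp [e.injective.extend_apply]
      · simp [Function.extend_apply' _ _ _ hk]
    rw [this, hasSum_extend_zero e.injective]
    exact hasSum_norm_sq_lp f
  { toFun := fun f => ⟨Function.extend e f 0, memℓp_two_of_hasSum (key f)⟩
    map_add' := fun f g => Subtype.ext <| by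
      have h := Function.extend_add e (f : ι → E) (g : ι → E) 0 0
      rwa [add_zero] at h
    map_smul' := fun c f => Subtype.ext <| by
      have h := Function.extend_smul c e (f : ι → E) 0
      rwa [smul_zero] at h
    norm_map' := fun f => by
      refine (pow_left_inj₀ (norm_nonneg _) (norm_nonneg _) two_ne_zero).1 ?_
      exact (hasSum_norm_sq_lp _).unique (key f) }

theorem lpExtend_apply {ι κ : Type*} (e : ι ↪ κ) (f : lp (fun _ : ι => E) 2) (i : ι) :
    lpExtend e f (e i) = f i := e.injective.extend_apply _ _ _

theorem lpExtend_apply_of_notMem {ι κ : Type*} (e : ι ↪ κ) (f : lp (fun _ : ι => E) 2) {k : κ}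
    (hk : ¬ ∃ i, e i = k) : lpExtend e f k = 0 := Function.extend_apply' _ _ _ hk

/-- The operator on `ℓ²(ι; E)` that applies `A` to each coefficient; for `ι = ℕ` it is `hardyConst
A`. -/
noncomputable def lpConst (ι : Type*) (A : E →L[ℂ] E) :
    lp (fun _ : ι => E) 2 →L[ℂ] lp (fun _ : ι => E) 2 :=
  have bound : ∀ (f : lp (fun _ : ι => E) 2) (s : Finset ι),
      ∑ n ∈ s, ‖A (f n)‖ ^ (2 : ℝ≥0∞).toReal ≤ (‖A‖ * ‖f‖) ^ (2 : ℝ≥0∞).toReal := by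
    intro f s
    rw [Real.mul_rpow (norm_nonneg _) (norm_nonneg _)]
    refine le_trans ?_ (mul_le_mul_of_nonneg_left
      (lp.sum_rpow_le_norm_rpow (by norm_num) f s) (by positivity))
    rw [Finset.mul_sum]
    refine Finset.sum_le_sum fun n _ => ?_
    rw [← Real.mul_rpow (norm_nonneg _) (norm_nonneg _)]
    exact Real.rpow_le_rpow (norm_nonneg _) (A.le_opNorm _) (by norm_num)
  LinearMap.mkContinuous
    { toFun := fun f => ⟨fun n => A (f n), memℓp_gen' (bound f)⟩
      map_add' := fun f g => by ext n; exact A.map_add (f n) (g n)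
      map_smul' := fun c f => by ext n; simp }
    ‖A‖ fun f => lp.norm_le_of_forall_sum_le (by norm_num) (by positivity) (bound f)

theorem lpConst_apply {ι : Type*} (A : E →L[ℂ] E) (f : lp (fun _ : ι => E) 2) (i : ι) :
    lpConst ι A f i = A (f i) := rfl

theorem lpConst_one (ι : Type*) : lpConst ι (1 : E →L[ℂ] E) = 1 := rfl

theorem lpConst_zero (ι : Type*) : lpConst ι (0 : E →L[ℂ] E) = 0 := rfl

theorem lpConst_mul {ι : Type*} (A B : E →L[ℂ] E) :
    lpConst ι A * lpConst ι B = lpConst ι (A * B) := rfl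

theorem lpConst_add {ι : Type*} (A B : E →L[ℂ] E) :
    lpConst ι A + lpConst ι B = lpConst ι (A + B) := rfl

theorem lpConst_star [CompleteSpace E] {ι : Type*} (A : E →L[ℂ] E) :
    star (lpConst ι A) = lpConst ι (star A) := by
  symm
  rw [ContinuousLinearMap.star_eq_adjoint, ContinuousLinearMap.star_eq_adjoint,
    ContinuousLinearMap.eq_adjoint_iff]
  intro f g
  rw [lp.inner_eq_tsum, lp.inner_eq_tsum]
  simp only [lpConst_apply, ContinuousLinearMap.adjoint_inner_left]

variable (E) in
/-- The bilateral shift on `ℓ²(ℤ; E)`, which moves the coefficient at `n` to `n + 1`. -/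
noncomputable def bilateralShift : lp (fun _ : ℤ => E) 2 →L[ℂ] lp (fun _ : ℤ => E) 2 :=
  (lpExtend (Equiv.addRight (1 : ℤ)).toEmbedding).toContinuousLinearMap

theorem bilateralShift_apply (f : lp (fun _ : ℤ => E) 2) (n : ℤ) :
    bilateralShift E f (n + 1) = f n :=
  lpExtend_apply (Equiv.addRight (1 : ℤ)).toEmbedding f n

theorem bilateralShift_mem_unitary [CompleteSpace E] :
    bilateralShift E ∈ unitary (lp (fun _ : ℤ => E) 2 →L[ℂ] lp (fun _ : ℤ => E) 2) := by
  have h1 : star (bilateralShift E) * bilateralShift E = 1 :=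
    (ContinuousLinearMap.norm_map_iff_adjoint_comp_self _).1
      (lpExtend (Equiv.addRight (1 : ℤ)).toEmbedding).norm_map
  let R : lp (fun _ : ℤ => E) 2 →L[ℂ] lp (fun _ : ℤ => E) 2 :=
    (lpExtend (Equiv.addRight (-1 : ℤ)).toEmbedding).toContinuousLinearMap
  have h2 : bilateralShift E * R = 1 := by
    ext f n
    obtain ⟨m, rfl⟩ : ∃ m, m + 1 = n := ⟨n - 1, by ring⟩
    refine (bilateralShift_apply (R f) m).trans ?_
    have := lpExtend_apply (Equiv.addRight (-1 : ℤ)).toEmbedding f (m + 1)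
    rwa [show (Equiv.addRight (-1 : ℤ)).toEmbedding (m + 1) = m from add_neg_cancel_right m 1]
      at this
  have h3 : star (bilateralShift E) = R := by
    rw [← mul_one (star _), ← h2, ← mul_assoc, h1, one_mul]
  exact ⟨h1, h3 ▸ h2⟩

theorem commute_bilateralShift (A : E →L[ℂ] E) : Commute (bilateralShift E) (lpConst ℤ A) := by
  ext f n
  obtain ⟨m, rfl⟩ : ∃ m, m + 1 = n := ⟨n - 1, by ring⟩
  refine (bilateralShift_apply (lpConst ℤ A f) m).trans ?_
  exact congrArg A (bilateralShift_apply f m).symm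

/-- The Laurent operator on `ℓ²(ℤ; E)`, that is on `L²` of the circle in terms of Fourier
coefficients, with symbol `A + z B`. -/
noncomputable def laurent (A B : E →L[ℂ] E) :
    lp (fun _ : ℤ => E) 2 →L[ℂ] lp (fun _ : ℤ => E) 2 :=
  lpConst ℤ A + bilateralShift E * lpConst ℤ B

variable (E) in
/-- The Hardy space as the subspace of `ℓ²(ℤ; E)` of the sequences supported on `ℕ`. -/
noncomputable def hardyInclusion : HardySpace E →ₗᵢ[ℂ] lp (fun _ : ℤ => E) 2 :=
  lpExtend Nat.castEmbedding

/-- Toeplitz operators with symbol `A + z B` are restrictions of the Laurent operators. -/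
theorem laurent_hardyInclusion (A B : E →L[ℂ] E) (f : HardySpace E) :
    laurent A B (hardyInclusion E f) = hardyInclusion E (toeplitz A B f) := by
  have hnat : ∀ (g : HardySpace E) (n : ℕ), hardyInclusion E g n = g n := fun g n =>
    lpExtend_apply Nat.castEmbedding g n
  have hneg : ∀ (g : HardySpace E) (n : ℤ), n < 0 → hardyInclusion E g n = 0 := fun g n hn =>
    lpExtend_apply_of_notMem _ g fun ⟨m, hm⟩ => by
      have : (m : ℤ) = n := hm
      omega
  ext n
  obtain ⟨m, rfl⟩ : ∃ m, m + 1 = n := ⟨n - 1, by ring⟩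
  have h1 : laurent A B (hardyInclusion E f) (m + 1) =
      A (hardyInclusion E f (m + 1)) + B (hardyInclusion E f m) :=
    congrArg (A (hardyInclusion E f (m + 1)) + ·)
      (bilateralShift_apply (lpConst ℤ B (hardyInclusion E f)) m)
  rw [h1]
  rcases lt_trichotomy (m + 1) 0 with hm | hm | hm
  · rw [hneg _ _ hm, hneg _ _ (by omega), hneg _ _ hm, map_zero, map_zero, add_zero]
  · have e : m + 1 = ((0 : ℕ) : ℤ) := hm
    rw [hneg _ m (by omega), e, hnat, hnat, map_zero]
    exact (congrArg (A (f 0) + ·) (hardyShift_zero (hardyConst B f))).symm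
  · obtain ⟨k, rfl⟩ := Int.eq_ofNat_of_zero_le (show 0 ≤ m by omega)
    have e : (k : ℤ) + 1 = ((k + 1 : ℕ) : ℤ) := rfl
    rw [e, hnat, hnat, hnat]
    exact (congrArg (A (f (k + 1)) + ·) (hardyShift_succ (hardyConst B f) k)).symm

theorem laurent_mul_laurent (A B C D : E →L[ℂ] E) :
    laurent A B * laurent C D = lpConst ℤ (A * C) + bilateralShift E * lpConst ℤ (A * D + B * C) +
      bilateralShift E * bilateralShift E * lpConst ℤ (B * D) := by
  simp only [laurent, ← lpConst_mul, ← lpConst_add, mul_add, add_mul]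
  rw [← mul_assoc (lpConst ℤ A) (bilateralShift E), ← (commute_bilateralShift A).eq,
    mul_assoc (bilateralShift E) (lpConst ℤ B) (bilateralShift E * _),
    ← mul_assoc (lpConst ℤ B) (bilateralShift E), ← (commute_bilateralShift B).eq]
  simp only [mul_assoc]
  abel

theorem star_laurent [CompleteSpace E] (A B : E →L[ℂ] E) :
    star (laurent A B) = star (bilateralShift E) * laurent (star B) (star A) := by
  rw [laurent, laurent, star_add, star_mul, lpConst_star, lpConst_star, mul_add, ← mul_assoc,
    Unitary.star_mul_self_of_mem (bilateralShift_mem_unitary (E := E)), one_mul, add_comm]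
  have := (commute_bilateralShift B).star_star.eq
  rw [lpConst_star] at this
  rw [this]

/-- The pairs of coefficients of the symbols `A + z B` in the Berger–Coburn–Lebow model: the
relations say that `A + z B` is unitary for every `z` on the unit circle. -/
structure IsBCLPair [CompleteSpace E] (A B : E →L[ℂ] E) : Prop where
  star_mul_self_add : star A * A + star B * B = 1
  mul_star_self_add : A * star A + B * star B = 1
  star_mul : star A * B = 0
  mul_star : A * star B = 0

/-- The symbols `A + z B` and `B* + z A*` are factors of `z`. -/
theorem IsBCLPair.laurent_mul [CompleteSpace E] {A B : E →L[ℂ] E} (h : IsBCLPair A B) :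
    laurent A B * laurent (star B) (star A) = bilateralShift E ∧
      laurent (star B) (star A) * laurent A B = bilateralShift E := by
  have h1 : B * star A = 0 := by simpa using congrArg star h.mul_star
  have h2 : star B * A = 0 := by simpa using congrArg star h.star_mul
  constructor
  · rw [laurent_mul_laurent, h.mul_star, h.mul_star_self_add, h1, lpConst_zero, lpConst_one,
      mul_zero, zero_add, add_zero, mul_one]
  · rw [laurent_mul_laurent, h.star_mul, add_comm (star B * B), h.star_mul_self_add, h2,
      lpConst_zero, lpConst_one, mul_zero, zero_add, add_zero, mul_one]

theorem IsBCLPair.laurent_mem_unitary [CompleteSpace E] {A B : E →L[ℂ] E} (h : IsBCLPair A B) :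
    laurent A B ∈ unitary (lp (fun _ : ℤ => E) 2 →L[ℂ] lp (fun _ : ℤ => E) 2) := by
  have hS : star (bilateralShift E) * bilateralShift E = 1 :=
    Unitary.star_mul_self_of_mem bilateralShift_mem_unitary
  have hc : laurent A B * star (bilateralShift E) = star (bilateralShift E) * laurent A B := by
    have hcS : Commute (bilateralShift E) (laurent A B) :=
      (commute_bilateralShift A).add_right ((Commute.refl _).mul_right (commute_bilateralShift B))
    have hS' : bilateralShift E * star (bilateralShift E) = 1 :=
      Unitary.mul_star_self_of_mem bilateralShift_mem_unitary
    calc _ = star (bilateralShift E) * bilateralShift E *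
            (laurent A B * star (bilateralShift E)) := by
          rw [hS, one_mul]
      _ = star (bilateralShift E) * (bilateralShift E * laurent A B) * star (bilateralShift E) := by
          simp only [mul_assoc]
      _ = star (bilateralShift E) * laurent A B * (bilateralShift E * star (bilateralShift E)) := by
          rw [hcS.eq]; simp only [mul_assoc]
      _ = _ := by rw [hS', mul_one]
  refine ⟨?_, ?_⟩
  · rw [star_laurent, mul_assoc, h.laurent_mul.2, hS]
  · rw [star_laurent, ← mul_assoc, hc, mul_assoc, h.laurent_mul.1, hS]

theorem IsBCLPair.star_swap [CompleteSpace E] {A B : E →L[ℂ] E} (h : IsBCLPair A B) :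
    IsBCLPair (star B) (star A) := by
  refine ⟨?_, ?_, ?_, ?_⟩
  · rw [star_star, star_star, add_comm, h.mul_star_self_add]
  · rw [star_star, star_star, add_comm, h.star_mul_self_add]
  · rw [star_star]; simpa using congrArg star h.mul_star
  · rw [star_star]; simpa using congrArg star h.star_mul

theorem IsBCLPair.of_star_left [CompleteSpace E] {A B : E →L[ℂ] E}
    (h1 : A * star A + star B * B = 1) (h2 : star A * A + B * star B = 1) (h3 : A * B = 0)
    (h4 : star A * star B = 0) : IsBCLPair (star A) B :=
  ⟨by rwa [star_star], by rwa [star_star], by rwa [star_star], h4⟩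

/-- For `W` unitary and `Q` a projection, `(Q^⊥ W, Q W)` is a pair as in the Berger–Coburn–Lebow
model. -/
theorem isBCLPair_of_unitary [CompleteSpace E] {W Q : E →L[ℂ] E} (hW : W ∈ unitary (E →L[ℂ] E))
    (hQ : IsStarProjection Q) : IsBCLPair ((1 - Q) * W) (Q * W) := by
  have h1 : star Q = Q := hQ.isSelfAdjoint
  have h2 : Q * Q = Q := hQ.isIdempotentElem
  have h3 : star W * W = 1 := hW.1
  have h4 : W * star W = 1 := hW.2
  have h5 : (1 - Q) * (1 - Q) = 1 - Q := hQ.one_sub.isIdempotentElem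
  refine ⟨?_, ?_, ?_, ?_⟩ <;>
    simp only [star_mul, star_sub, star_one, h1]
  · calc star W * (1 - Q) * ((1 - Q) * W) + star W * Q * (Q * W)
        = star W * ((1 - Q) * (1 - Q)) * W + star W * (Q * Q) * W := by simp only [mul_assoc]
      _ = star W * W := by rw [h5, h2]; noncomm_ring
      _ = 1 := h3
  · calc (1 - Q) * W * (star W * (1 - Q)) + Q * W * (star W * Q)
        = (1 - Q) * (W * star W) * (1 - Q) + Q * (W * star W) * Q := by simp only [mul_assoc]
      _ = 1 := by rw [h4, mul_one, mul_one, h5, h2, sub_add_cancel]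
  · calc star W * (1 - Q) * (Q * W) = star W * (Q - Q * Q) * W := by noncomm_ring
      _ = 0 := by rw [h2, sub_self, mul_zero, zero_mul]
  · calc (1 - Q) * W * (star W * Q) = (1 - Q) * (W * star W) * Q := by simp only [mul_assoc]
      _ = Q - Q * Q := by rw [h4]; noncomm_ring
      _ = 0 := by rw [h2, sub_self]

/-- The unitary `W = A + B` and the projection `Q = B B*` recover `A = Q^⊥ W` and `B = Q W`, and
`B* = W* Q`, `A* = W* Q^⊥`. -/
theorem IsBCLPair.exists_unitary_projection [CompleteSpace E] {A B : E →L[ℂ] E}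
    (h : IsBCLPair A B) : A + B ∈ unitary (E →L[ℂ] E) ∧ IsStarProjection (B * star B) ∧
      (1 - B * star B) * (A + B) = A ∧ B * star B * (A + B) = B ∧
      star (A + B) * (B * star B) = star B ∧ star (A + B) * (1 - B * star B) = star A := by
  have h1 : B * star A = 0 := by simpa using congrArg star h.mul_star
  have h2 : star B * A = 0 := by simpa using congrArg star h.star_mul
  have h3 : B * star B * B = B := by
    calc B * star B * B = B * (star A * A + star B * B) - B * star A * A := by noncomm_ring
      _ = B := by rw [h.star_mul_self_add, h1, zero_mul, mul_one, sub_zero]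
  have h4 : B * star B * (A + B) = B := by
    rw [mul_add, h3, mul_assoc, h2, mul_zero, zero_add]
  have h5 : star (A + B) * (B * star B) = star B := by simpa using congrArg star h4
  refine ⟨⟨?_, ?_⟩, ⟨?_, ?_⟩, ?_, h4, h5, ?_⟩
  · rw [star_add, add_mul, mul_add, mul_add, h.star_mul, h2, add_zero, zero_add,
      h.star_mul_self_add]
  · rw [star_add, add_mul, mul_add, mul_add, h.mul_star, h1, add_zero, zero_add,
      h.mul_star_self_add]
  · rw [IsIdempotentElem, ← mul_assoc, h3]
  · rw [IsSelfAdjoint, StarMul.star_mul, star_star]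
  · rw [sub_mul, h4, one_mul, add_sub_cancel_right]
  · rw [mul_sub, h5, mul_one, star_add, add_sub_cancel_right]

theorem IsStarProjection.star_mul_eq [CompleteSpace E] {Q : E →L[ℂ] E} (hQ : IsStarProjection Q)
    (W : E →L[ℂ] E) : star (Q * W) = star W * Q := by
  rw [star_mul, hQ.isSelfAdjoint.star_eq]

end Bilateral

/-! ### The model pair on the Hardy space -/

section Model

variable {H E : Type u} [NormedAddCommGroup H] [InnerProductSpace ℂ H] [CompleteSpace H]
  [NormedAddCommGroup E] [InnerProductSpace ℂ E]

theorem hardyShift_pow_apply_of_lt (f : HardySpace E) {n k : ℕ} (hk : k < n) :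
    (hardyShift ^ n) f k = 0 := by
  induction n generalizing k with
  | zero => omega
  | succ n ih =>
    rw [pow_succ']
    cases k with
    | zero => rfl
    | succ k => exact ih (by omega)

theorem toeplitz_zero_one : toeplitz 0 1 = (hardyShift : HardySpace E →L[ℂ] HardySpace E) := by
  ext f n
  exact zero_add (hardyShift f n)

/-- An operator unitarily equivalent to the unilateral shift is pure: the range of the `n`-th power
of the shift is orthogonal to the first `n` coefficients, so `‖V*ⁿ h‖` is at most the norm of the
remainder of `U h` after `n` terms. -/
theorem isPureContraction_of_shift {V : H →L[ℂ] H} (U : H ≃ₗᵢ[ℂ] HardySpace E)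
    (hU : ∀ h, U (V h) = hardyShift (U h)) (hV : ‖V‖ ≤ 1) : IsPureContraction V := by
  refine ⟨hV, fun h => ?_⟩
  have hpow : ∀ n h, U ((V ^ n) h) = (hardyShift ^ n) (U h) := by
    intro n h
    exact (pow_intertwine (J := U.toLinearIsometry) (fun x => (hU x).symm) n h).symm
  have hlim : Filter.Tendsto
      (fun n => ‖U h - ∑ i ∈ Finset.range n, lp.single 2 i ((U h : HardySpace E) i)‖)
      Filter.atTop (nhds 0) := by
    have := (lp.hasSum_single ENNReal.ofNat_ne_top (U h)).tendsto_sum_nat.const_sub (U h)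
    simpa using this.norm
  refine squeeze_zero_norm (fun n => ?_) hlim
  set f := ∑ i ∈ Finset.range n, lp.single 2 i ((U h : HardySpace E) i)
  set g := (star V ^ n) h with hg
  have hnV : ‖(V ^ n) g‖ ≤ ‖g‖ := by
    refine ((V ^ n).le_of_opNorm_le ?_ g).trans (one_mul _).le
    cases n with
    | zero => exact ContinuousLinearMap.norm_id_le
    | succ n => exact (norm_pow_le' V n.succ_pos).trans (pow_le_one₀ (norm_nonneg _) hV)
  -- the truncation `f` is orthogonal to the range of the `n`-th power of the shift
  have hf : inner ℂ f (U ((V ^ n) g)) = 0 := by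
    rw [hpow, sum_inner]
    refine Finset.sum_eq_zero fun i hi => ?_
    rw [lp.inner_single_left, hardyShift_pow_apply_of_lt _ (Finset.mem_range.1 hi),
      inner_zero_right]
  have h1 : ((‖g‖ ^ 2 : ℝ) : ℂ) = inner ℂ (U h - f) (U ((V ^ n) g)) := by
    rw [inner_sub_left, hf, sub_zero, U.inner_map_map, ← ContinuousLinearMap.adjoint_inner_left,
      ← ContinuousLinearMap.star_eq_adjoint, star_pow, ← hg, inner_self_eq_norm_sq_to_K]
    simp
  have h2 : ‖g‖ ^ 2 ≤ ‖U h - f‖ * ‖g‖ := by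
    have := congrArg norm h1
    rw [Complex.norm_real, Real.norm_of_nonneg (by positivity)] at this
    rw [this]
    refine (norm_inner_le_norm _ _).trans ?_
    rw [U.norm_map]
    gcongr
  rcases (norm_nonneg g).eq_or_lt with h0 | h0
  · rw [← h0]; positivity
  · exact le_of_mul_le_mul_right (by rwa [sq] at h2) h0

theorem isPureTriangularEIsometry_of_model [CompleteSpace E] {V₁ V₂ : H →L[ℂ] H}
    (U : H ≃ₗᵢ[ℂ] HardySpace E) {A B : E →L[ℂ] E} (hAB : IsBCLPair A B)
    (h1 : ∀ h, U (V₁ h) = toeplitz A B (U h))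
    (h2 : ∀ h, U (V₂ h) = toeplitz (star B) (star A) (U h))
    (h3 : ∀ h, U ((V₁ * V₂) h) = hardyShift (U h)) :
    IsPureTriangularEIsometry V₁ V₂ (V₁ * V₂) := by
  have htri : IsTriangularEIsometry V₁ V₂ (V₁ * V₂) :=
    isTriangularEIsometry_of_unitary_extension
      ((hardyInclusion E).comp U.toLinearIsometry) hAB.laurent_mem_unitary
      hAB.star_swap.laurent_mem_unitary (hAB.laurent_mul.1.trans hAB.laurent_mul.2.symm)
      (fun h => (laurent_hardyInclusion A B (U h)).trans (congrArg _ (h1 h).symm))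
      (fun h => (laurent_hardyInclusion _ _ (U h)).trans (congrArg _ (h2 h).symm))
  obtain ⟨S, T, -, hS, hT, rfl, rfl, -⟩ := htri.triangular
  exact ⟨htri, isPureContraction_of_shift U h3
    ((norm_mul_le _ _).trans (mul_le_one₀ hS (norm_nonneg _) hT))⟩

end Model

/-! ### The Wold decomposition of a pure isometry -/

section Wold

variable {H : Type u} [NormedAddCommGroup H] [InnerProductSpace ℂ H] [CompleteSpace H]

theorem star_apply_apply_of_isometry {V : H →L[ℂ] H} (hV : star V * V = 1) (x : H) :
    star V (V x) = x := congrArg (fun R : H →L[ℂ] H => R x) hV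

theorem inner_star_apply (T : H →L[ℂ] H) (x y : H) : inner ℂ (star T x) y = inner ℂ x (T y) :=
  ContinuousLinearMap.adjoint_inner_left T y x

/-- For an isometry `V`, the space `𝒟_{V*}` is the kernel of `V*`. -/
theorem mem_defectSpace_star_iff {V : H →L[ℂ] H} (hV : star V * V = 1) {x : H} :
    x ∈ defectSpace (star V) ↔ star V x = 0 := by
  constructor
  · intro hx
    have hle : defectSpace (star V) ≤ LinearMap.ker ((star V : H →L[ℂ] H) : H →ₗ[ℂ] H) := by
      refine Submodule.topologicalClosure_minimal _ ?_ (star V).isClosed_ker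
      rintro _ ⟨y, rfl⟩
      change star V (y - star (star V) (star V y)) = 0
      rw [star_star, map_sub, star_apply_apply_of_isometry hV, sub_self]
    exact hle hx
  · intro hx
    refine Submodule.le_topologicalClosure _ ⟨x, ?_⟩
    change x - star (star V) (star V x) = x
    rw [hx, map_zero, sub_zero]

theorem sub_mem_defectSpace {V : H →L[ℂ] H} (hV : star V * V = 1) (x : H) :
    x - V (star V x) ∈ defectSpace (star V) := by
  rw [mem_defectSpace_star_iff hV, map_sub, star_apply_apply_of_isometry hV, sub_self]

/-- For an isometry `V`, the projection `1 - V V*` of `H` onto `𝒟_{V*}`. -/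
noncomputable def defectProj {V : H →L[ℂ] H} (hV : star V * V = 1) :
    H →L[ℂ] defectSpace (star V) :=
  ContinuousLinearMap.codRestrict (1 - V * star V) (defectSpace (star V)) (sub_mem_defectSpace hV)

theorem coe_defectProj {V : H →L[ℂ] H} (hV : star V * V = 1) (x : H) :
    (defectProj hV x : H) = x - V (star V x) := rfl

theorem defectProj_coe {V : H →L[ℂ] H} (hV : star V * V = 1) (e : defectSpace (star V)) :
    defectProj hV (e : H) = e := by
  ext
  rw [coe_defectProj, (mem_defectSpace_star_iff hV).1 e.2, map_zero, sub_zero]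

theorem defectProj_apply_self {V : H →L[ℂ] H} (hV : star V * V = 1) (x : H) :
    defectProj hV (V x) = 0 := by
  ext
  rw [coe_defectProj, star_apply_apply_of_isometry hV, sub_self, ZeroMemClass.coe_zero]

theorem inner_defectProj_left {V : H →L[ℂ] H} (hV : star V * V = 1) (x : H)
    (e : defectSpace (star V)) : inner ℂ (defectProj hV x) e = inner ℂ x (e : H) := by
  rw [Submodule.coe_inner, coe_defectProj, inner_sub_left,
    ← ContinuousLinearMap.adjoint_inner_right, ← ContinuousLinearMap.star_eq_adjoint,
    (mem_defectSpace_star_iff hV).1 e.2, inner_zero_right, sub_zero]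

theorem norm_defectProj_sq {V : H →L[ℂ] H} (hV : star V * V = 1) (x : H) :
    ‖defectProj hV x‖ ^ 2 = ‖x‖ ^ 2 - ‖star V x‖ ^ 2 := by
  have h : ((‖defectProj hV x‖ ^ 2 : ℝ) : ℂ) = ((‖x‖ ^ 2 - ‖star V x‖ ^ 2 : ℝ) : ℂ) := by
    have h1 := inner_self_eq_norm_sq_to_K (𝕜 := ℂ) (defectProj hV x)
    have h2 := inner_self_eq_norm_sq_to_K (𝕜 := ℂ) (star V x)
    have h3 := inner_self_eq_norm_sq_to_K (𝕜 := ℂ) x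
    rw [inner_defectProj_left, coe_defectProj, inner_sub_right, ← inner_star_apply, h2, h3] at h1
    push_cast
    exact h1.symm
  exact_mod_cast h

/-- The sums telescope by `norm_defectProj_sq`, with remainder `‖V*ᴺ h‖²`. -/
theorem hasSum_norm_defectProj_sq {V : H →L[ℂ] H} (hV : star V * V = 1)
    (hpure : ∀ h : H, Filter.Tendsto (fun n : ℕ => (star V ^ n) h) Filter.atTop (nhds 0)) (h : H) :
    HasSum (fun n => ‖defectProj hV ((star V ^ n) h)‖ ^ 2) (‖h‖ ^ 2) := by
  rw [hasSum_iff_tendsto_nat_of_nonneg fun _ => sq_nonneg _]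
  have hs : ∀ N, ∑ n ∈ Finset.range N, ‖defectProj hV ((star V ^ n) h)‖ ^ 2 =
      ‖h‖ ^ 2 - ‖(star V ^ N) h‖ ^ 2 := by
    intro N
    rw [Finset.sum_congr rfl fun n _ => norm_defectProj_sq hV _]
    have := Finset.sum_range_sub' (fun n => ‖(star V ^ n) h‖ ^ 2) N
    simp only [pow_succ'] at this ⊢
    exact this
  simp only [hs]
  simpa using ((hpure h).norm.pow 2).const_sub (‖h‖ ^ 2)

/-- The Wold isometry of a pure isometry `V`: the coefficient of `h` at `n` is `(1 - V V*) V*ⁿ h`.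
-/
noncomputable def woldIsometry {V : H →L[ℂ] H} (hV : star V * V = 1)
    (hpure : ∀ h : H, Filter.Tendsto (fun n : ℕ => (star V ^ n) h) Filter.atTop (nhds 0)) :
    H →ₗᵢ[ℂ] HardySpace (defectSpace (star V)) where
  toFun h := ⟨fun n => defectProj hV ((star V ^ n) h),
    memℓp_two_of_hasSum (hasSum_norm_defectProj_sq hV hpure h)⟩
  map_add' f g := by
    ext1
    funext n
    exact ((defectProj hV) ∘L (star V ^ n)).map_add f g
  map_smul' c f := by
    ext1
    funext n
    exact ((defectProj hV) ∘L (star V ^ n)).map_smul c f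
  norm_map' h := by
    refine (pow_left_inj₀ (norm_nonneg _) (norm_nonneg _) two_ne_zero).1 ?_
    exact (hasSum_norm_sq_lp _).unique (hasSum_norm_defectProj_sq hV hpure h)

variable {V : H →L[ℂ] H} (hV : star V * V = 1)
    (hpure : ∀ h : H, Filter.Tendsto (fun n : ℕ => (star V ^ n) h) Filter.atTop (nhds 0))

theorem woldIsometry_apply (h : H) (n : ℕ) :
    woldIsometry hV hpure h n = defectProj hV ((star V ^ n) h) := rfl

theorem woldIsometry_shift (h : H) :
    woldIsometry hV hpure (V h) = hardyShift (woldIsometry hV hpure h) := by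
  ext1
  funext n
  cases n with
  | zero => exact defectProj_apply_self hV h
  | succ n =>
    rw [hardyShift_succ, woldIsometry_apply, woldIsometry_apply, pow_succ]
    exact congrArg (fun x => defectProj hV ((star V ^ n) x)) (star_apply_apply_of_isometry hV h)

/-- The monomial `zⁿ e` is the image of `Vⁿ e`. -/
theorem single_mem_range_woldIsometry (n : ℕ) (e : defectSpace (star V)) :
    lp.single 2 n e ∈ LinearMap.range (woldIsometry hV hpure).toLinearMap := by
  induction n with
  | zero =>
    refine ⟨(e : H), ?_⟩
    ext1
    funext k
    cases k with
    | zero =>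
      exact (defectProj_coe hV e).trans
        (lp.single_apply_self (E := fun _ => defectSpace (star V)) 2 0 e).symm
    | succ k =>
      refine Eq.trans ?_
        (lp.single_apply_ne (E := fun _ => defectSpace (star V)) 2 0 e k.succ_ne_zero).symm
      change defectProj hV ((star V ^ (k + 1)) e) = 0
      have : (star V ^ (k + 1)) (e : H) = (star V ^ k) (star V e) := by rw [pow_succ]; rfl
      rw [this, (mem_defectSpace_star_iff hV).1 e.2, map_zero, map_zero]
  | succ n ih =>
    obtain ⟨h, hh⟩ := ih
    refine ⟨V h, (woldIsometry_shift hV hpure h).trans ?_⟩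
    have hh : woldIsometry hV hpure h = lp.single 2 n e := hh
    rw [hh]
    ext1
    funext k
    cases k with
    | zero =>
      exact (lp.single_apply_ne (E := fun _ => defectSpace (star V)) 2 _ e
        (Nat.succ_ne_zero n).symm).symm
    | succ k => simp [hardyShift_succ, lp.single_apply, Pi.single_apply]

theorem woldIsometry_surjective : Function.Surjective (woldIsometry hV hpure) := by
  intro f
  have hcl : IsClosed (Set.range (woldIsometry hV hpure)) :=
    (woldIsometry hV hpure).isometry.isClosedEmbedding.isClosed_range
  refine hcl.mem_of_tendsto (lp.hasSum_single ENNReal.ofNat_ne_top f) (Filter.Eventually.of_forall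
    fun s => ?_)
  exact (LinearMap.range (woldIsometry hV hpure).toLinearMap).sum_mem
    fun n _ => single_mem_range_woldIsometry hV hpure n (f n)

end Wold

/-! ### Commuting isometries with a pure product -/

section CommutingIsometries

variable {H : Type u} [NormedAddCommGroup H] [InnerProductSpace ℂ H] [CompleteSpace H]

theorem star_apply_mem_defectSpace {V T : H →L[ℂ] H} (hV : star V * V = 1) (hT : Commute T V)
    (e : defectSpace (star V)) : star T e ∈ defectSpace (star V) := by
  rw [mem_defectSpace_star_iff hV]
  have : star V (star T e) = star T (star V e) :=
    congrArg (fun R : H →L[ℂ] H => R e) hT.symm.star_star.eq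
  rw [this, (mem_defectSpace_star_iff hV).1 e.2, map_zero]

/-- The restriction of `T*` to `𝒟_{V*} = ker V*`, which is invariant under `T*` if `T` commutes with
`V`. -/
noncomputable def adjointOnDefect {V T : H →L[ℂ] H} (hV : star V * V = 1) (hT : Commute T V) :
    defectSpace (star V) →L[ℂ] defectSpace (star V) :=
  ContinuousLinearMap.codRestrict (star T ∘L (defectSpace (star V)).subtypeL)
    (defectSpace (star V)) (star_apply_mem_defectSpace hV hT)

theorem coe_adjointOnDefect {V T : H →L[ℂ] H} (hV : star V * V = 1) (hT : Commute T V)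
    (e : defectSpace (star V)) : (adjointOnDefect hV hT e : H) = star T e := rfl

/-- The adjoint of the restriction of `T*` is the compression of `T`. -/
theorem star_adjointOnDefect {V T : H →L[ℂ] H} (hV : star V * V = 1) (hT : Commute T V)
    (e : defectSpace (star V)) : star (adjointOnDefect hV hT) e = defectProj hV (T e) := by
  refine ext_inner_right ℂ fun f => ?_
  rw [inner_defectProj_left, inner_star_apply, Submodule.coe_inner, coe_adjointOnDefect,
    ← inner_star_apply, star_star]

variable {V₁ V₂ : H →L[ℂ] H}

/-- The compression of `V₁` and the restriction of `V₂*` to `ker (V₁ V₂)*` satisfy the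
Berger–Coburn–Lebow relations, because `V₁ V₁* + V₂* (1 - V V*) V₂ = 1` and similar identities hold
on that kernel. -/
theorem isBCLPair_adjointOnDefect (h : Commute V₁ V₂) (h₁ : star V₁ * V₁ = 1)
    (h₂ : star V₂ * V₂ = 1)
    (hV : star (V₁ * V₂) * (V₁ * V₂) = 1) (c₁ : Commute V₁ (V₁ * V₂)) (c₂ : Commute V₂ (V₁ * V₂)) :
    IsBCLPair (star (adjointOnDefect hV c₁)) (adjointOnDefect hV c₂) := by
  have a₁ := star_apply_apply_of_isometry h₁
  have a₂ := star_apply_apply_of_isometry h₂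
  have m : ∀ x, (V₁ * V₂) x = V₁ (V₂ x) := fun _ => rfl
  have ms : ∀ x, star (V₁ * V₂) x = star V₁ (star V₂ x) := fun x => by
    rw [h.eq, star_mul]; rfl
  have c : ∀ x, V₂ (V₁ x) = V₁ (V₂ x) := fun x =>
    (congrArg (fun R : H →L[ℂ] H => R x) h.eq).symm
  have cs : ∀ x, star V₂ (star V₁ x) = star V₁ (star V₂ x) := fun x =>
    (congrArg (fun R : H →L[ℂ] H => R x) h.star_star.eq).symm
  have a₃ : ∀ x, star V₂ (V₁ (V₂ x)) = V₁ x := fun x => by rw [← c, a₂]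
  have a₄ : ∀ x, star V₁ (star V₂ (V₁ x)) = star V₂ x := fun x => by rw [← cs, a₁]
  have he : ∀ e : defectSpace (star (V₁ * V₂)), star V₁ (star V₂ (e : H)) = 0 := fun e => by
    rw [← ms]; exact (mem_defectSpace_star_iff hV).1 e.2
  have sA := fun e => congrArg Subtype.val (star_adjointOnDefect hV c₁ e)
  have sB := fun e => congrArg Subtype.val (star_adjointOnDefect hV c₂ e)
  refine IsBCLPair.of_star_left ?_ ?_ ?_ ?_ <;> ext e
  · change star V₁ (star (adjointOnDefect hV c₁) e : H) +
      (star (adjointOnDefect hV c₂) (adjointOnDefect hV c₂ e) : H) = e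
    simp only [sA, sB, coe_adjointOnDefect, coe_defectProj, m, ms, map_sub, a₁, a₂, a₄, he,
      map_zero]
    abel
  · change (star (adjointOnDefect hV c₁) (adjointOnDefect hV c₁ e) : H) +
      star V₂ (star (adjointOnDefect hV c₂) e : H) = e
    simp only [sA, sB, coe_adjointOnDefect, coe_defectProj, m, ms, map_sub, a₂, a₃, a₄, cs, he,
      map_zero]
    abel
  · exact he e
  · change (star (adjointOnDefect hV c₁) (star (adjointOnDefect hV c₂) e) : H) = 0
    simp only [sA, coe_defectProj, sB]
    simp only [m, ms, map_sub, a₁, a₂, a₃, a₄, c]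
    abel

/-- The Wold isometry of `V = T S = S T` carries `T` to the Toeplitz operator with symbol `A + z
B`, where `A` is the compression of `T` and `B` the restriction of `S*`. It rests on `V* T = S*`
and `S* V = T`. -/
theorem woldIsometry_apply_eq_toeplitz {V T S : H →L[ℂ] H} (hV : star V * V = 1)
    (hT : Commute T V) (hS : Commute S V) (hTS : T * S = V) (hST : S * T = V)
    (hT1 : star T * T = 1) (hS1 : star S * S = 1)
    (hpure : ∀ h : H, Filter.Tendsto (fun n : ℕ => (star V ^ n) h) Filter.atTop (nhds 0)) (h : H) :
    woldIsometry hV hpure (T h) =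
      toeplitz (star (adjointOnDefect hV hT)) (adjointOnDefect hV hS)
        (woldIsometry hV hpure h) := by
  have cTV : ∀ x, T (V x) = V (T x) := fun x => congrArg (fun R : H →L[ℂ] H => R x) hT.eq
  have aV := star_apply_apply_of_isometry hV
  have hVT : star V * T = star S := by
    rw [← hTS, star_mul, mul_assoc, hT1, mul_one]
  have hSV : star S * V = T := by rw [← hST, ← mul_assoc, hS1, one_mul]
  have aVT : ∀ x, star V (T x) = star S x := fun x => congrArg (fun R : H →L[ℂ] H => R x) hVT
  have aSV : ∀ x, star S (V x) = T x := fun x => congrArg (fun R : H →L[ℂ] H => R x) hSV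
  have cs : ∀ x, star S (star V x) = star V (star S x) := fun x =>
    congrArg (fun R : H →L[ℂ] H => R x) hS.star_star.eq
  ext1
  funext n
  cases n with
  | zero =>
    have h0 : woldIsometry hV hpure (T h) 0 =
        star (adjointOnDefect hV hT) (woldIsometry hV hpure h 0) := by
      rw [star_adjointOnDefect, woldIsometry_apply, woldIsometry_apply, coe_defectProj,
        map_sub, map_sub,
        cTV, defectProj_apply_self, sub_zero]
      rfl
    exact h0.trans (add_zero _).symm
  | succ n =>
    have h1 : (star V ^ (n + 1)) (T h) = star S ((star V ^ n) h) := by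
      have : star V ^ (n + 1) * T = star S * star V ^ n := by
        rw [pow_succ, mul_assoc, hVT, (hS.star_star.pow_right n).eq]
      exact congrArg (fun R : H →L[ℂ] H => R h) this
    have h2 : (star V ^ (n + 1)) h = star V ((star V ^ n) h) := by rw [pow_succ']; rfl
    have h3 : woldIsometry hV hpure (T h) (n + 1) =
        star (adjointOnDefect hV hT) (woldIsometry hV hpure h (n + 1)) +
          adjointOnDefect hV hS (woldIsometry hV hpure h n) := by
      rw [star_adjointOnDefect, woldIsometry_apply, woldIsometry_apply, woldIsometry_apply, h1, h2]
      ext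
      simp only [Submodule.coe_add, coe_defectProj, coe_adjointOnDefect]
      simp only [map_sub, aVT, aSV, cTV, cs, aV]
      abel
    exact h3

/-- The product is the restriction of a unitary, hence an isometry, which forces both of its
contractive factors to be isometries. -/
theorem IsTriangularEIsometry.isometries {V₁ V₂ V : H →L[ℂ] H}
    (h : IsTriangularEIsometry V₁ V₂ V) : star V₁ * V₁ = 1 ∧ star V₂ * V₂ = 1 ∧ star V * V = 1 := by
  obtain ⟨K, _, _, _, J, Q₁, Q₂, N, hN, hJ⟩ := h.isEIsometry.extension
  obtain ⟨S, T, hST, hS, hT, rfl, rfl, rfl⟩ := h.triangular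
  have hnorm : ∀ x, ‖(V₁ * V₂) x‖ = ‖x‖ := fun x => by
    rw [← J.norm_map, ← (hJ x).2.2, ← J.norm_map x]
    exact (ContinuousLinearMap.norm_map_iff_adjoint_comp_self N).2 hN.mem_unitary.1 (J x)
  have hle : ∀ {R : H →L[ℂ] H}, ‖R‖ ≤ 1 → ∀ x, ‖R x‖ ≤ ‖x‖ := fun hR x =>
    (ContinuousLinearMap.le_of_opNorm_le _ hR x).trans (one_mul _).le
  refine ⟨(ContinuousLinearMap.norm_map_iff_adjoint_comp_self V₁).1 fun x => ?_,
    (ContinuousLinearMap.norm_map_iff_adjoint_comp_self V₂).1 fun x => ?_,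
    (ContinuousLinearMap.norm_map_iff_adjoint_comp_self _).1 hnorm⟩
  · refine le_antisymm (hle hS x) ((hnorm x).symm.le.trans ?_)
    rw [hST.eq]
    exact hle hT (V₁ x)
  · exact le_antisymm (hle hT x) ((hnorm x).symm.le.trans (hle hS (V₂ x)))

end CommutingIsometries

/-! ### The characterization of pure triangular tetrablock-isometries -/

theorem theorem3 {H : Type u} [NormedAddCommGroup H] [InnerProductSpace ℂ H] [CompleteSpace H]
    (V₁ V₂ V : H →L[ℂ] H) (hcomm : CommutingTriple V₁ V₂ V) (hV : V = V₁ * V₂) :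
    IsPureTriangularEIsometry V₁ V₂ V ↔
      ∃ (U : H ≃ₗᵢ[ℂ] HardySpace (defectSpace (star V)))
        (W Q : defectSpace (star V) →L[ℂ] defectSpace (star V)),
        W ∈ unitary (defectSpace (star V) →L[ℂ] defectSpace (star V)) ∧
        IsStarProjection Q ∧
        (∀ h : H, U (V₁ h) = toeplitz ((1 - Q) * W) (Q * W) (U h)) ∧
        (∀ h : H, U (V₂ h) = toeplitz (star W * Q) (star W * (1 - Q)) (U h)) ∧
        (∀ h : H, U (V h) = toeplitz 0 1 (U h)) := by
  subst hV
  constructor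
  · intro h
    obtain ⟨i₁, i₂, i⟩ := h.triangular.isometries
    have hp := h.pure.2
    have c := hcomm.comm_AB
    obtain ⟨hW, hQ, hA, hB, hB', hA'⟩ :=
      (isBCLPair_adjointOnDefect c i₁ i₂ i hcomm.comm_AP hcomm.comm_BP).exists_unitary_projection
    refine ⟨LinearIsometryEquiv.ofSurjective (woldIsometry i hp) (woldIsometry_surjective i hp),
      _, _, hW, hQ, fun x => ?_, fun x => ?_, fun x => ?_⟩
    · rw [hA, hB]
      exact woldIsometry_apply_eq_toeplitz i hcomm.comm_AP hcomm.comm_BP rfl c.eq.symm i₁ i₂ hp x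
    · rw [hA', hB', star_star (adjointOnDefect i hcomm.comm_AP)]
      exact woldIsometry_apply_eq_toeplitz i hcomm.comm_BP hcomm.comm_AP c.eq.symm rfl i₂ i₁ hp x
    · rw [toeplitz_zero_one]
      exact woldIsometry_shift i hp x
  · rintro ⟨U, W, Q, hW, hQ, h₁, h₂, h₃⟩
    refine isPureTriangularEIsometry_of_model U (isBCLPair_of_unitary hW hQ) h₁ (fun x => ?_)
      fun x => ?_
    · rw [hQ.star_mul_eq W, hQ.one_sub.star_mul_eq W]
      exact h₂ x
    · rw [← toeplitz_zero_one]
      exact h₃ x
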